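/- **Channels and codes.** The $k$-receiver AWGN broadcast channel with feedback has outputs $Y_{ji}=X_i+Z_{ji}$ ($j=1,\dots,k$; $i=1,2,\dots$), where the noise vectors $\mathbf Z_i=(Z_{1i},\dots,Z_{ki})^T$ are i.i.d. $\mathrm N(0,K)$, with $K$ real positive semidefinite. A $(2^{nR_1},\dots,2^{nR_k},n)$ code consists of independent messages $M_j$, uniform on a set of $\lceil 2^{nR_j}\rceil$ elements and independent of the noise, an encoder that sends $X_i=X_i(\mathbf M,\mathbf Y_1,\dots,\mathbf Y_{i-1})$, and $k$ decoders $\hat M_j=\hat M_j(Y_{j1},\dots,Y_{jn})$ (all maps measurable). The vector $(R_1,\dots,R_k)$ is achievable under power constraint $P$ if there is a sequence of such codes ($n\to\infty$) with $\Pr(\hat M_j\ne M_j\text{ for some }j)\to0$ and $\limsup_{n\to\infty}\frac1n\sum_{i=1}^n\mathbb E|X_i|^2\le P$. For the complex channel, where $X_i\in\mathbb C$ and $\mathbf Z_i\sim\mathcal{CN}(0,K_z)$ is circularly symmetric ($\mathbb E\,\mathbf Z_i\mathbf Z_i'=K_z$, $\mathbb E\,\mathbf Z_i\mathbf Z_i^T=0$),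 the definition is the same, except that rates are counted per real dimension, that is, $M_j$ is uniform on a set of $\lceil 2^{2nR_j}\rceil$ elements. **Theorem.** Let $a_1,\dots,a_k\in\mathbb C$ be distinct with $|a_j|>1$, let $A=\mathrm{diag}(a_1,\dots,a_k)$ and $B=(1,\dots,1)'$ (a column of length $k$; $'$ is the conjugate transpose), and let $K_z\in\mathbb C^{k\times k}$ be Hermitian positive semidefinite. Then the following hold. 1. There is exactly one positive definite solution $G$ of the discrete algebraic Riccati equation $$G=A'GA-A'GB(B'GB+1)^{-1}B'GA$$ for which, with $C=(B'GB+1)^{-1}B'GA$, every eigenvalue of $A-BC$ lies inside the unit circle. 2. For this $G$ and $C$, the Lyapunov equation $K_s=(A-BC)K_s(A-BC)'+K_z$ has exactly one solution $K_s$. 3. $CK_sC'=\operatorname{tr}(GK_z)$, and this number, denoted by $P$, is real and nonnegative. 4. The rate vector $(\log_2|a_1|,\dots,\log_2|a_k|)$ is achievable under power constraint $P$ over the complex AWGN broadcast channel with feedback and noise $\mathcal{CN}(0,K_z)$. If $K_z$ is real, it is also achievable under power constraint $P$ over the real AWGN broadcast channel with feedback and noise $\mathrm N(0,K_z)$. 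-/

import Mathlib

open MeasureTheory Filter Topology Matrix
open scoped ENNReal NNReal ComplexOrder

noncomputable section

namespace BroadcastFeedback

/-! ### Feedback codes for the additive noise broadcast channel `Y_{ji} = X_i + Z_{ji}`

The symbols are in `𝕜`, which is `ℝ` (the channel itself) or `ℂ` (its complex version). Times are
`0, …, n - 1`, receivers are indexed by `Fin k`. -/

/-- A feedback code with `n` transmissions, `k` receivers and message sets of sizes `N j`:
the symbol sent at time `i` is a function of the messages and of the channel output vectors at the
times before `i`, and decoder `j` only sees the outputs of receiver `j`. -/
structure Code (𝕜 : Type) [MeasurableSpace 𝕜] (k n : ℕ) (N : Fin k → ℕ) where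
  /-- the encoder at time `i` -/
  enc : (i : Fin n) → ((j : Fin k) → Fin (N j)) → (Fin i → Fin k → 𝕜) → 𝕜
  /-- the decoder of receiver `j` -/
  dec : (j : Fin k) → (Fin n → 𝕜) → Fin (N j)
  measurable_enc : ∀ i m, Measurable (enc i m)
  measurable_dec : ∀ j, Measurable (dec j)

namespace Code

variable {𝕜 : Type} [MeasurableSpace 𝕜] [Add 𝕜] {k n : ℕ} {N : Fin k → ℕ}

/-- The vector of channel outputs at time `i`, when the messages are `m` and the noise is `z`. -/
def output (c : Code 𝕜 k n N) (m : (j : Fin k) → Fin (N j)) (z : Fin n → Fin k → 𝕜)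
    (i : Fin n) : Fin k → 𝕜 :=
  fun j => c.enc i m (fun l : Fin i => c.output m z ⟨l, l.2.trans i.2⟩) + z i j
termination_by i.val
decreasing_by exact l.2

/-- The symbol transmitted at time `i`, when the messages are `m` and the noise is `z`. -/
def input (c : Code 𝕜 k n N) (m : (j : Fin k) → Fin (N j)) (z : Fin n → Fin k → 𝕜)
    (i : Fin n) : 𝕜 :=
  c.enc i m (fun l : Fin i => c.output m z ⟨l, l.2.trans i.2⟩)

/-- The estimate of receiver `j`, when the messages are `m` and the noise is `z`. -/
def estimate (c : Code 𝕜 k n N) (m : (j : Fin k) → Fin (N j)) (z : Fin n → Fin k → 𝕜)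
    (j : Fin k) : Fin (N j) :=
  c.dec j (fun i => c.output m z i j)

end Code

/-- The joint law of messages and noise: the messages are independent and uniformly distributed,
the noise vectors at different times are i.i.d. with law `ν` and independent of the messages. -/
def jointLaw {𝕜 : Type} [MeasurableSpace 𝕜] {k : ℕ} (n : ℕ) (N : Fin k → ℕ)
    (ν : Measure (Fin k → 𝕜)) :
    Measure (((j : Fin k) → Fin (N j)) × (Fin n → Fin k → 𝕜)) :=
  (Measure.pi fun j => ProbabilityTheory.uniformOn (Set.univ : Set (Fin (N j)))).prod
    (Measure.pi fun _ : Fin n => ν)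

/-- The probability that some receiver decodes its message wrongly. -/
def Code.errorProb {𝕜 : Type} [MeasurableSpace 𝕜] [Add 𝕜] {k n : ℕ} {N : Fin k → ℕ}
    (c : Code 𝕜 k n N) (ν : Measure (Fin k → 𝕜)) : ℝ≥0∞ :=
  jointLaw n N ν {ω | ∃ j, c.estimate ω.1 ω.2 j ≠ ω.1 j}

/-- The average power `(1/n) ∑ᵢ E |X_i|²` (as an element of `[0, ∞]`). -/
def Code.avgPower {𝕜 : Type} [MeasurableSpace 𝕜] [NormedRing 𝕜] {k n : ℕ} {N : Fin k → ℕ}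
    (c : Code 𝕜 k n N) (ν : Measure (Fin k → 𝕜)) : ℝ≥0∞ :=
  (n : ℝ≥0∞)⁻¹ * ∑ i : Fin n, ∫⁻ ω, ‖c.input ω.1 ω.2 i‖ₑ ^ 2 ∂(jointLaw n N ν)

/-- The number of messages `2^{nR}` (rounded up) of rate `R` for block length `n`. -/
def numMessages (n : ℕ) (R : ℝ) : ℕ := ⌈(2 : ℝ) ^ ((n : ℝ) * R)⌉₊

/-- `R` is achievable under the asymptotic block power constraint `P` over the channel with noise
law `ν`: there is a sequence of codes, one for each block length `n`, with vanishing error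
probability and with `limsup` of the average powers at most `P`. Rates are in bits per real
dimension, and a channel use has `d` real dimensions (`d = 1` for `𝕜 = ℝ`, `d = 2` for `𝕜 = ℂ`),
so that receiver `j` has `2^{d n R_j}` messages. -/
def AchievableOver {𝕜 : Type} [MeasurableSpace 𝕜] [NormedRing 𝕜] (d : ℕ) {k : ℕ}
    (ν : Measure (Fin k → 𝕜)) (R : Fin k → ℝ) (P : ℝ≥0) : Prop :=
  ∃ c : (n : ℕ) → Code 𝕜 k n (fun j => numMessages (d * n) (R j)),
    Tendsto (fun n => (c n).errorProb ν) atTop (𝓝 0) ∧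
    limsup (fun n => (c n).avgPower ν) atTop ≤ (P : ℝ≥0∞)

/-- The Gaussian law `N(0, K)` on `ℝ^k`. -/
def realNoise {k : ℕ} (K : Matrix (Fin k) (Fin k) ℝ) : Measure (Fin k → ℝ) :=
  (ProbabilityTheory.multivariateGaussian (0 : EuclideanSpace ℝ (Fin k)) K).map
    (fun x i => x i)

/-- The circularly symmetric complex Gaussian law `CN(0, K)` on `ℂ^k`: the law of `Z = U + √-1 V`
with `(U, V)` jointly Gaussian, centred, `Cov U = Cov V = Re K / 2`, `E[V Uᵀ] = Im K / 2`
and `E[U Vᵀ] = - Im K / 2`. Thus `E[Z Zᴴ] = K` and `E[Z Zᵀ] = 0`. -/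
def complexNoise {k : ℕ} (K : Matrix (Fin k) (Fin k) ℂ) : Measure (Fin k → ℂ) :=
  (ProbabilityTheory.multivariateGaussian (0 : EuclideanSpace ℝ (Fin k ⊕ Fin k))
      ((1 / 2 : ℝ) • Matrix.fromBlocks (K.map Complex.re) (-K.map Complex.im)
        (K.map Complex.im) (K.map Complex.re))).map
    (fun x i => (⟨x (Sum.inl i), x (Sum.inr i)⟩ : ℂ))

/-- Achievable rate vectors (in bits per transmission) of the `k`-receiver AWGN broadcast channel
with feedback and noise covariance matrix `K`. -/
def Achievable {k : ℕ} (K : Matrix (Fin k) (Fin k) ℝ) (R : Fin k → ℝ) (P : ℝ≥0) : Prop :=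
  AchievableOver 1 (realNoise K) R P

/-- Achievable rate vectors (in bits per real dimension) of the complex `k`-receiver AWGN broadcast
channel with feedback and noise `CN(0, K)`, where `P` constrains `E |X|²`. -/
def ComplexAchievable {k : ℕ} (K : Matrix (Fin k) (Fin k) ℂ) (R : Fin k → ℝ) (P : ℝ≥0) : Prop :=
  AchievableOver 2 (complexNoise K) R P

/-! ### The control problem -/

/-- The open-loop matrix `A = diag(a_1, …, a_k)`. -/
def matA {k : ℕ} (a : Fin k → ℂ) : Matrix (Fin k) (Fin k) ℂ := Matrix.diagonal a

/-- The column `B = (1, …, 1)'`. -/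
def matB (k : ℕ) : Matrix (Fin k) (Fin 1) ℂ := Matrix.of fun _ _ => 1

/-- The row `C = (B'GB + 1)⁻¹ B'GA`. -/
def gainC {k : ℕ} (a : Fin k → ℂ) (G : Matrix (Fin k) (Fin k) ℂ) : Matrix (Fin 1) (Fin k) ℂ :=
  ((matB k)ᴴ * G * matB k + 1)⁻¹ * ((matB k)ᴴ * G * matA a)

/-- The closed-loop matrix `A - BC`. -/
def closedLoop {k : ℕ} (a : Fin k → ℂ) (G : Matrix (Fin k) (Fin k) ℂ) :
    Matrix (Fin k) (Fin k) ℂ :=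
  matA a - matB k * gainC a G

/-- The discrete algebraic Riccati equation `G = A'GA - A'GB (B'GB + 1)⁻¹ B'GA`. -/
def IsRiccatiSolution {k : ℕ} (a : Fin k → ℂ) (G : Matrix (Fin k) (Fin k) ℂ) : Prop :=
  G = (matA a)ᴴ * G * matA a -
    (matA a)ᴴ * G * matB k * ((matB k)ᴴ * G * matB k + 1)⁻¹ * ((matB k)ᴴ * G * matA a)

/-- A matrix is stable if its eigenvalues are inside the unit circle. -/
def IsStable {k : ℕ} (M : Matrix (Fin k) (Fin k) ℂ) : Prop :=
  ∀ μ ∈ spectrum ℂ M, ‖μ‖ < 1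

/-- Positive definite solutions of the Riccati equation with stable closed-loop matrix. -/
def IsStabilizingSolution {k : ℕ} (a : Fin k → ℂ) (G : Matrix (Fin k) (Fin k) ℂ) : Prop :=
  G.PosDef ∧ IsRiccatiSolution a G ∧ IsStable (closedLoop a G)

/-- The discrete algebraic Lyapunov equation `K_s = (A - BC) K_s (A - BC)' + K_z`. -/
def IsLyapunovSolution {k : ℕ} (a : Fin k → ℂ) (G Kz Ks : Matrix (Fin k) (Fin k) ℂ) : Prop :=
  Ks = closedLoop a G * Ks * (closedLoop a G)ᴴ + Kz

end BroadcastFeedback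

end

namespace BroadcastFeedback

/-! ### The control problem -/

section Control

variable {k : ℕ} {a : Fin k → ℂ}

/-! Inverting the unknown makes the control problem linear. By the matrix inversion lemma the
Riccati equation reads `G = A'(G⁻¹ + BB')⁻¹A`, so for positive definite `G` it says that `Q = G⁻¹`
solves the Stein equation `AQA' = Q + BB'`. As `A` is diagonal, this is solved entry by entry,
uniquely, by `gramian` (`isRiccatiSolution_iff_inv`). The solution is positive definite because it
is a sum of rank-one terms `A⁻ᵐBB'A'⁻ᵐ`, `m ≥ 1`, built on a Vandermonde system (`gramian_posDef`).
The closed loop `F = A - BC` is then similar to `A'⁻¹` (`closedLoop_eq`), so stability is automatic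
and the Lyapunov equation is also solved entrywise. The identity `C'C = G - F'GF` gives `CK_sC' =
tr(GK_z)` (`gainC_mul_mul`).

For the code, the messages choose an initial state `V` and the encoder sends `X = CS`, where `S`
follows `S ↦ AS - Y`. Since `Y = BX + Z`, the same state obeys the stable recursion `S ↦ FS - Z`
(`input_feedbackCode`), so its second moments stay bounded up to a decaying contribution of `V`, and
those of `CS` are at most `tr(GK_z)` plus such a term (`exists_stateForm_le`). On the other hand `A`
is diagonal, so receiver `j` can form, from its own outputs alone, `V_j - a_j⁻ʳ S_r(j)`
(`openState_apply`): an estimate of `V_j` with error of order `|a_j|⁻ʳ`.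

About `|a_j|²ʳ` constellation points in a square of side `L` have spacing of order `L|a_j|⁻ʳ`.
Chebyshev's inequality bounds the error probability by a multiple of `L⁻² + ρʳ`, while the transient
costs total energy of order `L²` (`exists_code`). Taking `L² = √(n+1)` makes both negligible, so the
rates `log₂|a_j|` themselves are reached. The argument uses only first and second moments of the
noise, so the complex channel and the real one (two uses per complex symbol) are treated together
through `Modulation`. -/

/-- The solution of the Stein equation `A Q A' = Q + B B'`. -/
noncomputable def gramian (a : Fin k → ℂ) : Matrix (Fin k) (Fin k) ℂ :=
  Matrix.of fun i j => (a i * star (a j) - 1)⁻¹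

/-- The inverse of `A'`. -/
noncomputable def adjInv (a : Fin k → ℂ) : Matrix (Fin k) (Fin k) ℂ :=
  Matrix.diagonal fun i => (star (a i))⁻¹

lemma mul_star_ne_one (ha1 : ∀ j, 1 < ‖a j‖) (i j : Fin k) : a i * star (a j) - 1 ≠ 0 := by
  intro h
  have h2 : ‖a i * star (a j)‖ = 1 := by rw [sub_eq_zero.1 h, norm_one]
  rw [norm_mul, norm_star] at h2
  nlinarith [ha1 i, ha1 j]

lemma hasSum_gramian (ha1 : ∀ j, 1 < ‖a j‖) (i j : Fin k) :
    HasSum (fun m : ℕ => (a i)⁻¹ ^ (m + 1) * star ((a j)⁻¹ ^ (m + 1))) (gramian a i j) := by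
  have hi : a i ≠ 0 := norm_pos_iff.1 (zero_lt_one.trans (ha1 i))
  have hj : star (a j) ≠ 0 := star_ne_zero.2 (norm_pos_iff.1 (zero_lt_one.trans (ha1 j)))
  have hlt : ‖(a i * star (a j))⁻¹‖ < 1 := by
    rw [norm_inv, norm_mul, norm_star]
    exact inv_lt_one_of_one_lt₀ (one_lt_mul_of_lt_of_le (ha1 i) (ha1 j).le)
  have h := (hasSum_geometric_of_norm_lt_one hlt).mul_left (a i * star (a j))⁻¹
  have hne := mul_star_ne_one ha1 i j
  have e1 : (fun m : ℕ => (a i)⁻¹ ^ (m + 1) * star ((a j)⁻¹ ^ (m + 1))) =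
      fun m : ℕ => (a i * star (a j))⁻¹ * (a i * star (a j))⁻¹ ^ m := by
    funext m
    rw [star_pow, star_inv₀, ← mul_pow, ← mul_inv, pow_succ']
  have e2 : gramian a i j = (a i * star (a j))⁻¹ * (1 - (a i * star (a j))⁻¹)⁻¹ := by
    simp only [gramian, Matrix.of_apply]
    have h1 : (1 - (a i * star (a j))⁻¹) ≠ 0 := by
      intro h0
      apply hne
      field_simp at h0
      linear_combination h0
    rw [← mul_inv, mul_sub, mul_one, mul_inv_cancel₀ (mul_ne_zero hi hj)]
  rw [e1, e2]
  exact h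

/-- The quadratic form at `x` is `∑ₘ |wₘ|²` with `wₘ = ∑ᵢ conj(xᵢ) aᵢ^{-(m+1)}`, by the geometric
series for the entries. Distinctness of the `aᵢ` keeps the `wₘ` from all vanishing when `x ≠ 0`. -/
lemma gramian_posDef (ha : Function.Injective a) (ha1 : ∀ j, 1 < ‖a j‖) :
    (gramian a).PosDef := by
  refine Matrix.PosDef.of_dotProduct_mulVec_pos ?_ fun x hx => ?_
  · ext i j
    simp [gramian, Matrix.conjTranspose_apply, mul_comm]
  · set w : ℕ → ℂ := fun m => ∑ i, star (x i) * (a i)⁻¹ ^ (m + 1) with hw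
    have hs : HasSum (fun m => ((‖w m‖ ^ 2 : ℝ) : ℂ)) (star x ⬝ᵥ (gramian a *ᵥ x)) := by
      have h1 : HasSum (fun m : ℕ => ∑ i, ∑ j, star (x i) *
          ((a i)⁻¹ ^ (m + 1) * star ((a j)⁻¹ ^ (m + 1)) * x j))
          (star x ⬝ᵥ (gramian a *ᵥ x)) := by
        simp only [dotProduct, mulVec, Finset.mul_sum, Pi.star_apply]
        exact hasSum_sum fun i _ => hasSum_sum fun j _ =>
          ((hasSum_gramian ha1 i j).mul_right _).mul_left _
      convert h1 using 2 with m
      rw [← Complex.normSq_eq_norm_sq, ← Complex.mul_conj, ← Complex.star_def, hw]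
      simp only [star_sum, star_mul', star_star, Finset.sum_mul_sum]
      refine Finset.sum_congr rfl fun i _ => Finset.sum_congr rfl fun j _ => by ring
    obtain ⟨m, hm⟩ : ∃ m, w m ≠ 0 := by
      by_contra! hcon
      -- Vandermonde at the distinct nodes `aᵢ⁻¹`; one factor `aᵢ⁻¹` is moved into the coefficients
      -- because the powers start at 1.
      have hv : (fun i => star (x i) * (a i)⁻¹) = 0 := by
        refine Matrix.eq_zero_of_forall_pow_sum_mul_pow_eq_zero (f := fun i => (a i)⁻¹)
          (fun i j hij => ha (inv_injective hij)) fun m => ?_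
        rw [← hcon m, hw]
        exact Finset.sum_congr rfl fun i _ => by ring
      apply hx
      funext i
      have := congrFun hv i
      simpa [norm_pos_iff.1 (zero_lt_one.trans (ha1 i))] using this
    have hre := Complex.hasSum_re hs
    simp only [Complex.ofReal_re] at hre
    have him := Complex.hasSum_im hs
    simp only [Complex.ofReal_im] at him
    rw [Complex.lt_def]
    refine ⟨?_, (him.unique hasSum_zero).symm⟩
    have := hasSum_lt (f := fun _ : ℕ => (0 : ℝ)) (i := m) (fun n => sq_nonneg _)
      (by have := norm_pos_iff.2 hm; positivity) hasSum_zero hre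
    simpa using this

lemma matA_mul_mul_apply (a : Fin k → ℂ) (Q : Matrix (Fin k) (Fin k) ℂ) (i j : Fin k) :
    (matA a * Q * (matA a)ᴴ) i j = a i * Q i j * star (a j) := by
  rw [matA, Matrix.diagonal_conjTranspose, Matrix.mul_diagonal, Matrix.diagonal_mul,
    Pi.star_apply]

lemma matB_mul_apply (i j : Fin k) : (matB k * (matB k)ᴴ) i j = 1 := by
  simp [matB, Matrix.mul_apply]

lemma stein_gramian (ha1 : ∀ j, 1 < ‖a j‖) :
    matA a * gramian a * (matA a)ᴴ = gramian a + matB k * (matB k)ᴴ := by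
  ext i j
  have := mul_star_ne_one ha1 i j
  rw [Matrix.add_apply, matA_mul_mul_apply, matB_mul_apply, gramian, Matrix.of_apply]
  field_simp
  ring

lemma stein_unique (ha1 : ∀ j, 1 < ‖a j‖) {Q : Matrix (Fin k) (Fin k) ℂ}
    (hQ : matA a * Q * (matA a)ᴴ = Q + matB k * (matB k)ᴴ) : Q = gramian a := by
  ext i j
  have h := congrFun (congrFun hQ i) j
  rw [Matrix.add_apply, matA_mul_mul_apply, matB_mul_apply] at h
  rw [gramian, Matrix.of_apply]
  have := mul_star_ne_one ha1 i j
  field_simp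
  linear_combination h

lemma adjInv_mul (ha1 : ∀ j, 1 < ‖a j‖) : adjInv a * (matA a)ᴴ = 1 := by
  have (i : Fin k) : a i ≠ 0 := norm_pos_iff.1 (zero_lt_one.trans (ha1 i))
  rw [adjInv, matA, Matrix.diagonal_conjTranspose, Matrix.diagonal_mul_diagonal,
    ← Matrix.diagonal_one]
  congr 1
  funext i
  simp [this i]

/-- The matrix `(G⁻¹ + B B')⁻¹`, in the form given by the matrix inversion lemma. -/
noncomputable def innovation (G : Matrix (Fin k) (Fin k) ℂ) : Matrix (Fin k) (Fin k) ℂ :=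
  G - G * matB k * ((matB k)ᴴ * G * matB k + 1)⁻¹ * ((matB k)ᴴ * G)

lemma isUnit_scalar {G : Matrix (Fin k) (Fin k) ℂ} (hG : G.PosDef) :
    IsUnit ((matB k)ᴴ * G * matB k + 1).det :=
  (Matrix.isUnit_iff_isUnit_det _).1
    ((Matrix.PosDef.posSemidef_add (hG.posSemidef.conjTranspose_mul_mul_same _)
      Matrix.PosDef.one).isUnit)

lemma innovation_mul {G : Matrix (Fin k) (Fin k) ℂ} (hG : G.PosDef) :
    innovation G * (G⁻¹ + matB k * (matB k)ᴴ) = 1 := by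
  have hGu : IsUnit G.det := (Matrix.isUnit_iff_isUnit_det _).1 hG.isUnit
  have hs := Matrix.nonsing_inv_mul _ (isUnit_scalar hG)
  set B := matB k
  set s := Bᴴ * G * B + 1
  have hs' : s⁻¹ * (Bᴴ * G * B) = 1 - s⁻¹ := by
    have : Bᴴ * G * B = s - 1 := by simp [s]
    rw [this, mul_sub, hs, mul_one]
  have e1 : G * G⁻¹ = 1 := Matrix.mul_nonsing_inv _ hGu
  calc innovation G * (G⁻¹ + B * Bᴴ)
      = G * G⁻¹ + G * B * Bᴴ - G * B * s⁻¹ * Bᴴ * (G * G⁻¹)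
        - G * B * (s⁻¹ * (Bᴴ * G * B)) * Bᴴ := by
        simp only [innovation, B, s, Matrix.mul_add, Matrix.sub_mul, Matrix.mul_assoc]
        abel
    _ = 1 := by
        rw [hs', e1]
        simp only [Matrix.mul_sub, Matrix.sub_mul, Matrix.mul_one]
        abel

lemma isRiccatiSolution_iff {G : Matrix (Fin k) (Fin k) ℂ} :
    IsRiccatiSolution a G ↔ G = (matA a)ᴴ * innovation G * matA a := by
  rw [IsRiccatiSolution, innovation]
  simp only [Matrix.mul_sub, Matrix.sub_mul, Matrix.mul_assoc]

/-- Since `innovation G` is the inverse of `G⁻¹ + BB'`, inverting both sides turns the quadratic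
equation for `G` into the linear Stein equation for `G⁻¹`. Both existence and uniqueness of `G` come
from this. -/
lemma isRiccatiSolution_iff_inv (ha1 : ∀ j, 1 < ‖a j‖) {G : Matrix (Fin k) (Fin k) ℂ}
    (hG : G.PosDef) : IsRiccatiSolution a G ↔ G⁻¹ = gramian a := by
  have hGu : IsUnit G.det := (Matrix.isUnit_iff_isUnit_det _).1 hG.isUnit
  have e1 : G * G⁻¹ = 1 := Matrix.mul_nonsing_inv _ hGu
  have hM := innovation_mul hG
  rw [isRiccatiSolution_iff]
  constructor
  · intro h
    apply stein_unique ha1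
    have h1 : (matA a)ᴴ * innovation G * (matA a * G⁻¹) = 1 := by
      rw [← mul_assoc, ← h, e1]
    have h2 : matA a * G⁻¹ * ((matA a)ᴴ * innovation G) = 1 := mul_eq_one_comm.1 h1
    rw [← mul_assoc] at h2
    calc matA a * G⁻¹ * (matA a)ᴴ
        = matA a * G⁻¹ * (matA a)ᴴ * (innovation G * (G⁻¹ + matB k * (matB k)ᴴ)) := by
          rw [hM, mul_one]
      _ = _ := by rw [← mul_assoc, h2, one_mul]
  · intro h
    have h1 := stein_gramian ha1
    rw [← h] at h1
    rw [← h1, ← mul_assoc, ← mul_assoc] at hM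
    have h2 : (matA a)ᴴ * (innovation G * matA a * G⁻¹) = 1 := mul_eq_one_comm.1 hM
    calc G = (matA a)ᴴ * (innovation G * matA a * G⁻¹) * G := by rw [h2, one_mul]
      _ = (matA a)ᴴ * innovation G * matA a * (G⁻¹ * G) := by simp only [mul_assoc]
      _ = _ := by rw [Matrix.nonsing_inv_mul _ hGu, mul_one]

/-- `F = G⁻¹ · innovation G · A`, and the Riccati equation rewrites `innovation G · A` as `A'⁻¹G`.
The resulting diagonalization yields stability, decay of powers and the Lyapunov solution. -/
lemma closedLoop_eq (ha1 : ∀ j, 1 < ‖a j‖) {G : Matrix (Fin k) (Fin k) ℂ}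
    (hG : G.PosDef) (h : IsRiccatiSolution a G) :
    closedLoop a G = G⁻¹ * adjInv a * G := by
  have hGu : IsUnit G.det := (Matrix.isUnit_iff_isUnit_det _).1 hG.isUnit
  have h1 : innovation G * matA a = adjInv a * G := by
    have := isRiccatiSolution_iff.1 h
    conv_rhs => rw [this]
    rw [← mul_assoc, ← mul_assoc, adjInv_mul ha1, one_mul]
  rw [mul_assoc, ← h1, innovation, closedLoop, gainC, ← mul_assoc, mul_sub]
  simp only [← mul_assoc, ← Matrix.mul_assoc]
  rw [Matrix.nonsing_inv_mul _ hGu]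
  simp only [sub_mul, Matrix.mul_assoc, one_mul, Matrix.one_mul]

lemma isStable_closedLoop (ha1 : ∀ j, 1 < ‖a j‖) {G : Matrix (Fin k) (Fin k) ℂ}
    (hG : G.PosDef) (h : IsRiccatiSolution a G) : IsStable (closedLoop a G) := by
  intro μ hμ
  rw [closedLoop_eq ha1 hG h] at hμ
  obtain ⟨u, hu⟩ := hG.isUnit
  rw [← hu, ← Matrix.coe_units_inv, spectrum.units_conjugate', adjInv,
    spectrum_diagonal] at hμ
  obtain ⟨i, rfl⟩ := hμ
  rw [norm_inv, norm_star]
  exact inv_lt_one_of_one_lt₀ (ha1 i)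

lemma existsUnique_isStabilizingSolution (ha : Function.Injective a) (ha1 : ∀ j, 1 < ‖a j‖) :
    ∃! G : Matrix (Fin k) (Fin k) ℂ, IsStabilizingSolution a G := by
  have hQ := gramian_posDef ha ha1
  have hQu : IsUnit (gramian a).det := (Matrix.isUnit_iff_isUnit_det _).1 hQ.isUnit
  have hR : IsRiccatiSolution a (gramian a)⁻¹ :=
    (isRiccatiSolution_iff_inv ha1 hQ.inv).2 (Matrix.nonsing_inv_nonsing_inv _ hQu)
  refine ⟨(gramian a)⁻¹, ⟨hQ.inv, hR, isStable_closedLoop ha1 hQ.inv hR⟩, fun G hG => ?_⟩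
  have hGu : IsUnit G.det := (Matrix.isUnit_iff_isUnit_det _).1 hG.1.isUnit
  rw [← (isRiccatiSolution_iff_inv ha1 hG.1).1 hG.2.1, Matrix.nonsing_inv_nonsing_inv _ hGu]

/-- Expand the left factor as `F' = A' - C'B'`: the Riccati equation says `A'GF = G`, and the
definition of the gain says `B'GF = C`. -/
lemma closedLoop_conjTranspose_mul_mul {G : Matrix (Fin k) (Fin k) ℂ}
    (hG : G.PosDef) (h : IsRiccatiSolution a G) :
    (closedLoop a G)ᴴ * G * closedLoop a G = G - (gainC a G)ᴴ * gainC a G := by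
  have hs := Matrix.mul_nonsing_inv _ (isUnit_scalar hG)
  have hGF : (matA a)ᴴ * G * closedLoop a G = G := by
    conv_rhs => rw [h]
    simp only [closedLoop, gainC, Matrix.mul_sub, Matrix.mul_assoc]
  have hBF : (matB k)ᴴ * G * closedLoop a G = gainC a G := by
    have h2 : ((matB k)ᴴ * G * matB k + 1) * gainC a G = (matB k)ᴴ * G * matA a := by
      rw [gainC, ← Matrix.mul_assoc, hs, Matrix.one_mul]
    rw [closedLoop, Matrix.mul_sub, ← h2, Matrix.add_mul, Matrix.one_mul, ← Matrix.mul_assoc]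
    abel
  calc (closedLoop a G)ᴴ * G * closedLoop a G
      = (matA a)ᴴ * G * closedLoop a G -
          (gainC a G)ᴴ * ((matB k)ᴴ * G * closedLoop a G) := by
        conv_lhs => enter [1, 1]; rw [closedLoop]
        simp only [Matrix.conjTranspose_sub, Matrix.conjTranspose_mul, Matrix.sub_mul,
          Matrix.mul_assoc]
    _ = _ := by rw [hGF, hBF]

/-- The substitution `T = G K_s G` replaces `F` by the diagonal `A'⁻¹`. The `(i, j)` entry of the
equation is then a scalar linear equation with coefficient `1 - 1/(conj(aᵢ) aⱼ) ≠ 0`. -/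
lemma existsUnique_isLyapunovSolution (ha1 : ∀ j, 1 < ‖a j‖) {G : Matrix (Fin k) (Fin k) ℂ}
    (hG : G.PosDef) (h : IsRiccatiSolution a G) (Kz : Matrix (Fin k) (Fin k) ℂ) :
    ∃! Ks, IsLyapunovSolution a G Kz Ks := by
  have hGu : IsUnit G.det := (Matrix.isUnit_iff_isUnit_det _).1 hG.isUnit
  have e1 : G * G⁻¹ = 1 := Matrix.mul_nonsing_inv _ hGu
  have e2 : G⁻¹ * G = 1 := Matrix.nonsing_inv_mul _ hGu
  have hF := closedLoop_eq ha1 hG h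
  have hFt : (closedLoop a G)ᴴ = G * (adjInv a)ᴴ * G⁻¹ := by
    rw [hF, Matrix.conjTranspose_mul, Matrix.conjTranspose_mul, hG.isHermitian.eq,
      hG.inv.isHermitian.eq, mul_assoc]
  have key (T : Matrix (Fin k) (Fin k) ℂ) : T = adjInv a * T * (adjInv a)ᴴ + G * Kz * G ↔
      T = Matrix.of fun i j => (1 - (star (a i))⁻¹ * (a j)⁻¹)⁻¹ * (G * Kz * G) i j := by
    simp only [← Matrix.ext_iff, Matrix.add_apply, adjInv, Matrix.diagonal_conjTranspose,
      Matrix.mul_diagonal, Matrix.diagonal_mul, Matrix.of_apply]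
    refine forall_congr' fun i => forall_congr' fun j => ?_
    have hne : 1 - (star (a i))⁻¹ * (a j)⁻¹ ≠ 0 := by
      have h1 := mul_star_ne_one ha1 j i
      have hi : star (a i) ≠ 0 := star_ne_zero.2 (norm_pos_iff.1 (zero_lt_one.trans (ha1 i)))
      have hj : a j ≠ 0 := norm_pos_iff.1 (zero_lt_one.trans (ha1 j))
      intro h0
      apply h1
      field_simp at h0
      linear_combination h0
    rw [eq_inv_mul_iff_mul_eq₀ hne]
    simp only [Pi.star_apply, star_inv₀, star_star]
    constructor
    · intro h'
      linear_combination h'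
    · intro h'
      linear_combination h'
  have equiv (Ks : Matrix (Fin k) (Fin k) ℂ) : IsLyapunovSolution a G Kz Ks ↔
      G * Ks * G = adjInv a * (G * Ks * G) * (adjInv a)ᴴ + G * Kz * G := by
    rw [IsLyapunovSolution, hFt, hF]
    constructor
    · intro h'
      conv_lhs => rw [h']
      calc G * (G⁻¹ * adjInv a * G * Ks * (G * (adjInv a)ᴴ * G⁻¹) + Kz) * G
          = (G * G⁻¹) * (adjInv a * (G * Ks * G) * (adjInv a)ᴴ) * (G⁻¹ * G)
            + G * Kz * G := by noncomm_ring
        _ = _ := by rw [e1, e2, one_mul, mul_one]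
    · intro h'
      calc Ks = (G⁻¹ * G) * Ks * (G * G⁻¹) := by rw [e1, e2, one_mul, mul_one]
        _ = G⁻¹ * (G * Ks * G) * G⁻¹ := by noncomm_ring
        _ = G⁻¹ * (adjInv a * (G * Ks * G) * (adjInv a)ᴴ + G * Kz * G) * G⁻¹ := by rw [← h']
        _ = G⁻¹ * adjInv a * G * Ks * (G * (adjInv a)ᴴ * G⁻¹)
            + (G⁻¹ * G) * Kz * (G * G⁻¹) := by noncomm_ring
        _ = _ := by rw [e1, e2, one_mul, mul_one]
  set T := Matrix.of fun i j => (1 - (star (a i))⁻¹ * (a j)⁻¹)⁻¹ * (G * Kz * G) i j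
  have hGT : G * (G⁻¹ * T * G⁻¹) * G = T := by
    calc G * (G⁻¹ * T * G⁻¹) * G = (G * G⁻¹) * T * (G⁻¹ * G) := by noncomm_ring
      _ = T := by rw [e1, e2, one_mul, mul_one]
  refine ⟨G⁻¹ * T * G⁻¹, ?_, fun Ks hKs => ?_⟩
  · change IsLyapunovSolution a G Kz _
    rw [equiv, hGT, key]
  · have := (key _).1 ((equiv Ks).1 hKs)
    change _ = T at this
    rw [← this]
    calc Ks = (G⁻¹ * G) * Ks * (G * G⁻¹) := by rw [e1, e2, one_mul, mul_one]
      _ = _ := by noncomm_ring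

/-- Insert `C'C = G - F'GF` on one side and `K_z = K_s - F K_s F'` on the other; cyclicity of the
trace makes the two agree. -/
lemma gainC_mul_mul {G Kz Ks : Matrix (Fin k) (Fin k) ℂ} (hG : G.PosDef)
    (h : IsRiccatiSolution a G) (hKs : IsLyapunovSolution a G Kz Ks) :
    (gainC a G * Ks * (gainC a G)ᴴ) 0 0 = (G * Kz).trace := by
  set F := closedLoop a G
  set C := gainC a G
  have h1 : C * Ks * Cᴴ = Matrix.of fun _ _ => (C * Ks * Cᴴ).trace := by
    ext i j
    simp [Matrix.trace, Subsingleton.elim i 0, Subsingleton.elim j 0]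
  rw [h1, Matrix.of_apply, Matrix.trace_mul_comm, ← Matrix.mul_assoc]
  have h2 : Cᴴ * C = G - Fᴴ * G * F := by
    rw [closedLoop_conjTranspose_mul_mul hG h]
    abel
  rw [h2, Matrix.sub_mul, Matrix.trace_sub]
  have h3 : Kz = Ks - F * Ks * Fᴴ := by
    conv_rhs => enter [1]; rw [hKs]
    abel
  conv_rhs => rw [h3]
  rw [Matrix.mul_sub, Matrix.trace_sub, Matrix.mul_assoc, Matrix.mul_assoc,
    Matrix.trace_mul_comm Fᴴ]
  simp only [Matrix.mul_assoc]

lemma trace_mul_nonneg {G Kz : Matrix (Fin k) (Fin k) ℂ} (hG : G.PosSemidef)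
    (hK : Kz.PosSemidef) : 0 ≤ (G * Kz).trace := by
  obtain ⟨M, rfl⟩ : ∃ M : Matrix (Fin k) (Fin k) ℂ, Kz = Mᴴ * M := by
    open scoped MatrixOrder in
    exact CStarAlgebra.nonneg_iff_eq_star_mul_self.1 hK.nonneg
  rw [← Matrix.mul_assoc, Matrix.trace_mul_comm, ← Matrix.mul_assoc]
  exact (hG.mul_mul_conjTranspose_same M).trace_nonneg

end Control

/-! ### The closed-loop system -/

section ClosedLoop

variable {k : ℕ} {a : Fin k → ℂ}

/-- The second moment of `v · Z` for a noise vector with `E[Z Z'] = K`. -/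
noncomputable def noiseForm (K : Matrix (Fin k) (Fin k) ℂ) (v : Fin k → ℂ) : ℝ :=
  (∑ i, ∑ j, v i * K i j * star (v j)).re

/-- The states of the system `S_{r+1} = F S_r - w_r` with initial state `V`. -/
def closedState (F : Matrix (Fin k) (Fin k) ℂ) (V : Fin k → ℂ) (w : ℕ → Fin k → ℂ) :
    ℕ → Fin k → ℂ
  | 0 => V
  | r + 1 => F *ᵥ closedState F V w r - w r

/-- Variation of constants, tested against a row `x`. The subtraction `r - 1 - l` is never
truncated, as `l < r`. -/
lemma dotProduct_closedState (F : Matrix (Fin k) (Fin k) ℂ) (V : Fin k → ℂ)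
    (w : ℕ → Fin k → ℂ) (r : ℕ) (x : Fin k → ℂ) :
    x ⬝ᵥ closedState F V w r =
      x ⬝ᵥ (F ^ r *ᵥ V) - ∑ l ∈ Finset.range r, (x ᵥ* F ^ (r - 1 - l)) ⬝ᵥ w l := by
  induction r generalizing x with
  | zero => simp [closedState]
  | succ r ih =>
    rw [closedState, dotProduct_sub, dotProduct_mulVec, ih, Finset.sum_range_succ]
    have h1 : (x ᵥ* F) ⬝ᵥ (F ^ r *ᵥ V) = x ⬝ᵥ (F ^ (r + 1) *ᵥ V) := by
      rw [← dotProduct_mulVec, mulVec_mulVec, ← pow_succ']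
    have h2 : ∑ l ∈ Finset.range r, (x ᵥ* F ᵥ* F ^ (r - 1 - l)) ⬝ᵥ w l =
        ∑ l ∈ Finset.range r, (x ᵥ* F ^ (r + 1 - 1 - l)) ⬝ᵥ w l := by
      refine Finset.sum_congr rfl fun l hl => ?_
      rw [vecMul_vecMul, ← pow_succ']
      have := Finset.mem_range.1 hl
      congr 3
      omega
    rw [h1, h2]
    simp
    ring

lemma noiseForm_neg (K : Matrix (Fin k) (Fin k) ℂ) (v : Fin k → ℂ) :
    noiseForm K (-v) = noiseForm K v := by
  simp [noiseForm]

lemma noiseForm_row (K : Matrix (Fin k) (Fin k) ℂ) (C : Matrix (Fin 1) (Fin k) ℂ) :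
    noiseForm K (C 0) = (Cᴴ * C * K).trace.re := by
  rw [Matrix.mul_assoc, Matrix.trace_mul_comm, Matrix.trace_fin_one, noiseForm]
  simp only [Matrix.mul_apply, Matrix.conjTranspose_apply, Finset.sum_mul]
  rw [Finset.sum_comm]

/-- A telescoping sum: sandwiching `C'C = G - F'GF` between powers of `F` makes each summand a
difference of consecutive terms. Hence the noise part of the input power never exceeds `tr(GK)`, at
any finite time. -/
lemma sum_noiseForm_gainC {G : Matrix (Fin k) (Fin k) ℂ} (hG : G.PosDef)
    (h : IsRiccatiSolution a G) (K : Matrix (Fin k) (Fin k) ℂ) (r : ℕ) :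
    ∑ s ∈ Finset.range r, noiseForm K (gainC a G 0 ᵥ* closedLoop a G ^ s) =
      ((G - (closedLoop a G ^ r)ᴴ * G * closedLoop a G ^ r) * K).trace.re := by
  induction r with
  | zero => simp
  | succ r ih =>
    have h1 : gainC a G 0 ᵥ* closedLoop a G ^ r = (gainC a G * closedLoop a G ^ r) 0 := by
      funext j
      simp [Matrix.mul_apply, vecMul, dotProduct]
    have h2 := closedLoop_conjTranspose_mul_mul hG h
    rw [Finset.sum_range_succ, ih, h1, noiseForm_row, ← Complex.add_re, ← Matrix.trace_add,
      ← Matrix.add_mul]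
    congr 4
    rw [pow_succ']
    set F := closedLoop a G
    set C := gainC a G
    have h3 : (F * F ^ r)ᴴ * G * (F * F ^ r) = (F ^ r)ᴴ * (Fᴴ * G * F) * F ^ r := by
      simp only [Matrix.conjTranspose_mul, Matrix.mul_assoc]
    rw [h3, h2]
    simp only [Matrix.conjTranspose_mul, Matrix.mul_assoc, Matrix.mul_sub, Matrix.sub_mul]
    abel

lemma sum_noiseForm_gainC_le {G K : Matrix (Fin k) (Fin k) ℂ} (hG : G.PosDef)
    (h : IsRiccatiSolution a G) (hK : K.PosSemidef) (r : ℕ) :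
    ∑ s ∈ Finset.range r, noiseForm K (gainC a G 0 ᵥ* closedLoop a G ^ s) ≤
      (G * K).trace.re := by
  rw [sum_noiseForm_gainC hG h, Matrix.sub_mul, Matrix.trace_sub, Complex.sub_re]
  have := (Complex.le_def.1
    (trace_mul_nonneg (hG.posSemidef.conjTranspose_mul_mul_same (closedLoop a G ^ r)) hK)).1
  rw [Complex.zero_re] at this
  linarith

lemma noiseForm_le (K : Matrix (Fin k) (Fin k) ℂ) {v : Fin k → ℂ} {t : ℝ}
    (hv : ∀ j, ‖v j‖ ≤ t) : noiseForm K v ≤ (∑ i, ∑ j, ‖K i j‖) * t ^ 2 := by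
  refine (Complex.re_le_norm _).trans ?_
  rw [Finset.sum_mul]
  refine (norm_sum_le _ _).trans (Finset.sum_le_sum fun i _ => ?_)
  rw [Finset.sum_mul]
  refine (norm_sum_le _ _).trans (Finset.sum_le_sum fun j _ => ?_)
  rw [norm_mul, norm_mul, norm_star]
  have h0 := (norm_nonneg (v i)).trans (hv i)
  calc ‖v i‖ * ‖K i j‖ * ‖v j‖ = ‖K i j‖ * (‖v i‖ * ‖v j‖) := by ring
    _ ≤ ‖K i j‖ * (t * t) := by gcongr <;> exact hv _
    _ = _ := by ring

/-- `Fʳ = G⁻¹ A'⁻ʳ G`, so the decay rate can be taken as the largest `|aⱼ|⁻¹`. -/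
lemma exists_norm_closedLoop_pow_le (ha1 : ∀ j, 1 < ‖a j‖) {G : Matrix (Fin k) (Fin k) ℂ}
    (hG : G.PosDef) (h : IsRiccatiSolution a G) :
    ∃ ρ c : ℝ, 0 ≤ ρ ∧ ρ < 1 ∧ 0 ≤ c ∧ ∀ r i j, ‖(closedLoop a G ^ r) i j‖ ≤ c * ρ ^ r := by
  set ρ := ‖fun j => (a j)⁻¹‖ with hρ
  have hρ1 : ρ < 1 := (pi_norm_lt_iff zero_lt_one).2 fun j => by
    rw [norm_inv]
    exact inv_lt_one_of_one_lt₀ (ha1 j)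
  have hGu : IsUnit G.det := (Matrix.isUnit_iff_isUnit_det _).1 hG.isUnit
  have hpow (r : ℕ) : closedLoop a G ^ r = G⁻¹ * adjInv a ^ r * G := by
    induction r with
    | zero => simp [Matrix.nonsing_inv_mul _ hGu]
    | succ r ih =>
      rw [pow_succ, ih, closedLoop_eq ha1 hG h]
      calc G⁻¹ * adjInv a ^ r * G * (G⁻¹ * adjInv a * G)
          = G⁻¹ * adjInv a ^ r * (G * G⁻¹) * adjInv a * G := by simp only [mul_assoc]
        _ = _ := by
          rw [Matrix.mul_nonsing_inv _ hGu, mul_one, pow_succ]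
          simp only [mul_assoc]
  refine ⟨ρ, ∑ i, ∑ j, ∑ l, ‖G⁻¹ i l‖ * ‖G l j‖, norm_nonneg _, hρ1, by positivity,
    fun r i j => ?_⟩
  have h1 : ‖(closedLoop a G ^ r) i j‖ ≤ (∑ l, ‖G⁻¹ i l‖ * ‖G l j‖) * ρ ^ r := by
    rw [hpow, adjInv, Matrix.diagonal_pow, Matrix.mul_apply, Finset.sum_mul]
    refine (norm_sum_le _ _).trans (Finset.sum_le_sum fun l _ => ?_)
    rw [Matrix.mul_diagonal, norm_mul, norm_mul, Pi.pow_apply, norm_pow, norm_inv, norm_star,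
      ← norm_inv]
    have : ‖(a l)⁻¹‖ ≤ ρ := norm_le_pi_norm (fun j => (a j)⁻¹) l
    calc ‖G⁻¹ i l‖ * ‖(a l)⁻¹‖ ^ r * ‖G l j‖ = ‖G⁻¹ i l‖ * ‖G l j‖ * ‖(a l)⁻¹‖ ^ r := by ring
      _ ≤ _ := by gcongr
  refine h1.trans (mul_le_mul_of_nonneg_right ?_ (pow_nonneg (norm_nonneg _) r))
  refine (Finset.single_le_sum (f := fun j => ∑ l, ‖G⁻¹ i l‖ * ‖G l j‖)
    (fun _ _ => by positivity) (Finset.mem_univ j)).trans ?_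
  exact Finset.single_le_sum (f := fun i => ∑ j, ∑ l, ‖G⁻¹ i l‖ * ‖G l j‖)
    (fun _ _ => by positivity) (Finset.mem_univ i)

/-- The second moment of `x · S_r` for the closed-loop system driven by white noise. -/
noncomputable def stateForm (F K : Matrix (Fin k) (Fin k) ℂ) (V x : Fin k → ℂ) (r : ℕ) : ℝ :=
  ‖x ⬝ᵥ (F ^ r *ᵥ V)‖ ^ 2 + ∑ s ∈ Finset.range r, noiseForm K (x ᵥ* F ^ s)

/-- The input `C · S_r` needs the sharp constant `tr(GK)`, which is the power claimed; for the
coordinates of the state any constant suffices, since it is only compared with `L²`. The constants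
depend neither on `V` nor on `L`, so `L` may later grow with the block length. -/
lemma exists_stateForm_le (ha1 : ∀ j, 1 < ‖a j‖) {G K : Matrix (Fin k) (Fin k) ℂ}
    (hG : G.PosDef) (h : IsRiccatiSolution a G) (hK : K.PosSemidef) :
    ∃ ρ c : ℝ, 0 ≤ ρ ∧ ρ < 1 ∧ 0 ≤ c ∧ ∀ (V : Fin k → ℂ) (L : ℝ), (∀ j, ‖V j‖ ≤ L) → ∀ r,
      stateForm (closedLoop a G) K V (gainC a G 0) r ≤ (G * K).trace.re + c * (ρ ^ r * L) ^ 2 ∧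
      ∀ j, stateForm (closedLoop a G) K V (Pi.single j 1) r ≤ c + c * (ρ ^ r * L) ^ 2 := by
  obtain ⟨ρ, c, hρ0, hρ1, hc, hF⟩ := exists_norm_closedLoop_pow_le ha1 hG h
  set F := closedLoop a G
  set C := gainC a G 0
  have hrow (x : Fin k → ℂ) (s : ℕ) (j : Fin k) :
      ‖(x ᵥ* F ^ s) j‖ ≤ (∑ i, ‖x i‖) * c * ρ ^ s := by
    rw [vecMul, dotProduct, mul_assoc, Finset.sum_mul]
    refine (norm_sum_le _ _).trans (Finset.sum_le_sum fun i _ => ?_)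
    rw [norm_mul]
    exact mul_le_mul_of_nonneg_left (hF s i j) (norm_nonneg _)
  have hinit (x V : Fin k → ℂ) (L : ℝ) (hV : ∀ j, ‖V j‖ ≤ L) (r : ℕ) :
      ‖x ⬝ᵥ (F ^ r *ᵥ V)‖ ^ 2 ≤ (k * ((∑ i, ‖x i‖) * c)) ^ 2 * (ρ ^ r * L) ^ 2 := by
    rw [← mul_pow]
    refine pow_le_pow_left₀ (norm_nonneg _) ?_ 2
    rw [dotProduct_mulVec, dotProduct]
    refine (norm_sum_le _ _).trans ?_
    calc ∑ j, ‖(x ᵥ* F ^ r) j * V j‖ ≤ ∑ _j : Fin k, (∑ i, ‖x i‖) * c * ρ ^ r * L := by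
          refine Finset.sum_le_sum fun j _ => ?_
          rw [norm_mul]
          exact mul_le_mul (hrow x r j) (hV j) (norm_nonneg _) (by positivity)
      _ = _ := by
          rw [Finset.sum_const, Finset.card_univ, Fintype.card_fin, nsmul_eq_mul]
          ring
  set κ := ∑ i, ∑ j, ‖K i j‖
  have hκ : 0 ≤ κ := by positivity
  have hunit (j : Fin k) : ∑ i, ‖(Pi.single j 1 : Fin k → ℂ) i‖ = 1 := by
    rw [Finset.sum_eq_single j]
    · simp
    · intro i _ hij
      simp [Pi.single_eq_of_ne hij]
    · simp
  have hgeo (r : ℕ) : ∑ s ∈ Finset.range r, (ρ ^ 2) ^ s ≤ (1 - ρ ^ 2)⁻¹ :=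
    sum_le_hasSum _ (fun _ _ => by positivity)
      (hasSum_geometric_of_lt_one (by positivity) (by nlinarith))
  have hpos : 0 ≤ (1 - ρ ^ 2)⁻¹ := inv_nonneg.2 (by nlinarith)
  refine ⟨ρ, (k * ((∑ i, ‖C i‖) * c)) ^ 2 + (k * c) ^ 2 + κ * c ^ 2 * (1 - ρ ^ 2)⁻¹, hρ0, hρ1,
    by positivity, fun V L hV r => ⟨?_, fun j => ?_⟩⟩
  · have h1 := hinit C V L hV r
    have h2 := sum_noiseForm_gainC_le hG h hK r
    have h3 : 0 ≤ ((k * c) ^ 2 + κ * c ^ 2 * (1 - ρ ^ 2)⁻¹) * (ρ ^ r * L) ^ 2 := by positivity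
    unfold stateForm
    linarith
  · have h1 := hinit (Pi.single j 1) V L hV r
    rw [hunit, one_mul] at h1
    have h2 : ∑ s ∈ Finset.range r, noiseForm K (Pi.single j 1 ᵥ* F ^ s) ≤
        κ * c ^ 2 * (1 - ρ ^ 2)⁻¹ := by
      calc ∑ s ∈ Finset.range r, noiseForm K (Pi.single j 1 ᵥ* F ^ s)
          ≤ ∑ s ∈ Finset.range r, κ * c ^ 2 * (ρ ^ 2) ^ s := by
            refine Finset.sum_le_sum fun s _ => ?_
            refine (noiseForm_le K (hrow (Pi.single j 1) s)).trans (le_of_eq ?_)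
            rw [hunit]
            ring
        _ ≤ _ := by
            rw [← Finset.mul_sum]
            exact mul_le_mul_of_nonneg_left (hgeo r) (by positivity)
    have h3 : 0 ≤ ((k * ((∑ i, ‖C i‖) * c)) ^ 2 + κ * c ^ 2 * (1 - ρ ^ 2)⁻¹) *
      (ρ ^ r * L) ^ 2 := by positivity
    have h4 : 0 ≤ (k * ((∑ i, ‖C i‖) * c)) ^ 2 + (k * c) ^ 2 := by positivity
    unfold stateForm
    linarith

end ClosedLoop

open ProbabilityTheory

/-! ### Second moments of linear functionals of the noise -/

section Moments

/-- Independence and zero means remove all cross terms; this is additivity of variance plus the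
square of the constant. -/
lemma integral_sq_add_sum_pi {E : Type} [MeasurableSpace E] {ν : Measure E}
    [IsProbabilityMeasure ν] {n : ℕ} {g : Fin n → E → ℝ} (hg : ∀ i, MemLp (g i) 2 ν)
    (hg0 : ∀ i, ∫ x, g i x ∂ν = 0) (c : ℝ) :
    ∫ z, (c + ∑ i, g i (z i)) ^ 2 ∂(Measure.pi fun _ : Fin n => ν) =
      c ^ 2 + ∑ i, ∫ x, g i x ^ 2 ∂ν := by
  have hmp (i : Fin n) := measurePreserving_eval (fun _ : Fin n => ν) i
  have hgi (i : Fin n) : MemLp (fun z : Fin n → E => g i (z i)) 2 (Measure.pi fun _ => ν) :=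
    (hg i).comp_measurePreserving (hmp i)
  have hsum : MemLp (fun z : Fin n → E => ∑ i, g i (z i)) 2 (Measure.pi fun _ => ν) :=
    memLp_finsetSum _ fun i _ => hgi i
  have hmean : ∫ z, ∑ i, g i (z i) ∂(Measure.pi fun _ : Fin n => ν) = 0 := by
    rw [integral_finsetSum _ fun i _ => (hgi i).integrable one_le_two]
    refine Finset.sum_eq_zero fun i _ => ?_
    have := integral_map (hmp i).measurable.aemeasurable
      ((hmp i).map_eq.symm ▸ (hg i).aestronglyMeasurable)
    rw [(hmp i).map_eq, hg0] at this
    exact this.symm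
  have hvar := variance_sum_pi (μ := fun _ : Fin n => ν) hg
  have e : (∑ i, fun ω : Fin n → E => g i (ω i)) = fun ω => ∑ i, g i (ω i) := by
    funext ω
    simp
  rw [e, variance_eq_sub hsum, hmean] at hvar
  have hi (i : Fin n) : Var[g i; ν] = ∫ x, g i x ^ 2 ∂ν := by
    rw [variance_eq_sub (hg i), hg0]
    simp
  simp only [hi, Pi.pow_apply] at hvar
  have hexp : (fun z : Fin n → E => (c + ∑ i, g i (z i)) ^ 2) =
      fun z => (c ^ 2 + 2 * c * ∑ i, g i (z i)) + (∑ i, g i (z i)) ^ 2 := by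
    funext z
    ring
  rw [hexp, integral_add, integral_add, integral_const_mul, hmean]
  · simp
    linarith
  · exact integrable_const _
  · exact (hsum.integrable one_le_two).const_mul _
  · exact (integrable_const _).add ((hsum.integrable one_le_two).const_mul _)
  · exact hsum.integrable_sq

lemma integral_norm_sq_eq {E : Type} [MeasurableSpace E] {μ : Measure E} {f : E → ℂ}
    (hf : MemLp f 2 μ) :
    ∫ x, ‖f x‖ ^ 2 ∂μ = ∫ x, (f x).re ^ 2 ∂μ + ∫ x, (f x).im ^ 2 ∂μ := by
  have hre : MemLp (fun x => (f x).re) 2 μ := hf.re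
  have him : MemLp (fun x => (f x).im) 2 μ := hf.im
  rw [← integral_add hre.integrable_sq him.integrable_sq]
  refine integral_congr_ae (.of_forall fun x => ?_)
  simp only
  rw [← Complex.normSq_eq_norm_sq, Complex.normSq_apply]
  ring

lemma lintegral_enorm_sq_eq {E : Type} [MeasurableSpace E] {μ : Measure E} {f : E → ℂ}
    (hf : MemLp f 2 μ) : ∫⁻ x, ‖f x‖ₑ ^ 2 ∂μ = ENNReal.ofReal (∫ x, ‖f x‖ ^ 2 ∂μ) := by
  rw [ofReal_integral_eq_lintegral_ofReal (hf.integrable_norm_pow two_ne_zero)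
    (.of_forall fun _ => by positivity)]
  refine lintegral_congr fun x => ?_
  rw [ENNReal.ofReal_pow (norm_nonneg _), ofReal_norm]

lemma lintegral_enorm_sq_add_sum_pi {E : Type} [MeasurableSpace E] {ν : Measure E}
    [IsProbabilityMeasure ν] {n : ℕ} {g : Fin n → E → ℂ} (hg : ∀ i, MemLp (g i) 2 ν)
    (hg0 : ∀ i, ∫ x, g i x ∂ν = 0) (c : ℂ) :
    ∫⁻ z, ‖c + ∑ i, g i (z i)‖ₑ ^ 2 ∂(Measure.pi fun _ : Fin n => ν) =
      ENNReal.ofReal (‖c‖ ^ 2 + ∑ i, ∫ x, ‖g i x‖ ^ 2 ∂ν) := by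
  have hgi (i : Fin n) : MemLp (fun z : Fin n → E => g i (z i)) 2 (Measure.pi fun _ => ν) :=
    (hg i).comp_measurePreserving (measurePreserving_eval (fun _ : Fin n => ν) i)
  have hsum : MemLp (fun z : Fin n → E => c + ∑ i, g i (z i)) 2 (Measure.pi fun _ => ν) :=
    (memLp_const c).add (memLp_finsetSum _ fun i _ => hgi i)
  have hre (i : Fin n) : ∫ x, (g i x).re ∂ν = 0 := by
    have := integral_re (𝕜 := ℂ) ((hg i).integrable one_le_two)
    simpa [hg0 i] using this
  have him (i : Fin n) : ∫ x, (g i x).im ∂ν = 0 := by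
    have := integral_im (𝕜 := ℂ) ((hg i).integrable one_le_two)
    simpa [hg0 i] using this
  rw [lintegral_enorm_sq_eq hsum, integral_norm_sq_eq hsum]
  simp only [Complex.add_re, Complex.add_im, Complex.re_sum, Complex.im_sum]
  rw [integral_sq_add_sum_pi (g := fun i x => (g i x).re) (fun i => (hg i).re) hre,
    integral_sq_add_sum_pi (g := fun i x => (g i x).im) (fun i => (hg i).im) him]
  congr 1
  simp only [integral_norm_sq_eq (hg _), Finset.sum_add_distrib]
  rw [← Complex.normSq_eq_norm_sq, Complex.normSq_apply]
  ring

end Moments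

/-! ### Complex symbols on a channel with symbols in `𝕜` -/

section Modulation

lemma sum_range_mul_eq {M : Type*} [AddCommMonoid M] (f : ℕ → M) (b r : ℕ) :
    ∑ i ∈ Finset.range (b * r), f i =
      ∑ l ∈ Finset.range r, ∑ t ∈ Finset.range b, f (b * l + t) := by
  induction r with
  | zero => simp
  | succ r ih => rw [Nat.mul_succ, Finset.sum_range_add, ih, Finset.sum_range_succ]

/-- The extension of a finite sequence by zero. -/
def extend {𝕜 : Type} [Zero 𝕜] {k n : ℕ} (y : Fin n → Fin k → 𝕜) (i : ℕ) : Fin k → 𝕜 :=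
  if h : i < n then y ⟨i, h⟩ else 0

lemma sum_range_extend {𝕜 : Type} [Zero 𝕜] {k n : ℕ} (h : ℕ → (Fin k → 𝕜) → ℂ) (h0 : ∀ i, h i 0 = 0) (N : ℕ)
    (z : Fin n → Fin k → 𝕜) :
    ∑ i ∈ Finset.range N, h i (extend z i) =
      ∑ i : Fin n, if (i : ℕ) < N then h i (z i) else 0 := by
  have e : ∑ i : Fin n, (if (i : ℕ) < N then h i (z i) else 0) =
      ∑ i ∈ Finset.range n, if i < N then h i (extend z i) else 0 := by
    rw [Finset.sum_range]
    refine Finset.sum_congr rfl fun i _ => ?_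
    simp [extend]
  rw [e, ← Finset.sum_filter]
  symm
  refine Finset.sum_subset (fun i hi => ?_) fun i hi hi' => ?_
  · simp only [Finset.mem_filter, Finset.mem_range] at hi ⊢
    exact hi.2
  · simp only [Finset.mem_filter, Finset.mem_range] at hi hi'
    rw [extend, dif_neg (by tauto), h0]

/-- A way to send one complex symbol in a block of `b` uses of a channel over `𝕜`. -/
structure Modulation (𝕜 : Type) [MeasurableSpace 𝕜] [NormedRing 𝕜] (b : ℕ) where
  /-- the `t`-th channel symbol for a complex symbol -/
  split : ℕ → ℂ → 𝕜
  /-- the contribution of the `t`-th channel output to the complex output -/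
  merge : ℕ → 𝕜 → ℂ
  pos : 0 < b
  measurable_split : ∀ t, Measurable (split t)
  measurable_merge : ∀ t, Measurable (merge t)
  merge_add : ∀ t x y, merge t (x + y) = merge t x + merge t y
  merge_split : ∀ x, ∑ t ∈ Finset.range b, merge t (split t x) = x
  norm_split : ∀ x, ∑ t ∈ Finset.range b, ‖split t x‖ ^ 2 = b * ‖x‖ ^ 2

variable {𝕜 : Type} [MeasurableSpace 𝕜] [NormedRing 𝕜] {k b : ℕ}

/-- `ν` is a centred noise law for which the merged noise of a block has covariance `K`. -/
structure Modulation.IsNoise (M : Modulation 𝕜 b) (ν : Measure (Fin k → 𝕜))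
    (K : Matrix (Fin k) (Fin k) ℂ) : Prop where
  isProbabilityMeasure : IsProbabilityMeasure ν
  memLp : ∀ (t : ℕ) (v : Fin k → ℂ), MemLp (fun z => ∑ j, v j * M.merge t (z j)) 2 ν
  mean : ∀ (t : ℕ) (v : Fin k → ℂ), ∫ z, ∑ j, v j * M.merge t (z j) ∂ν = 0
  second : ∀ t < b, ∀ v : Fin k → ℂ, ∫ z, ‖∑ j, v j * M.merge t (z j)‖ ^ 2 ∂ν = (b : ℝ)⁻¹ * noiseForm K v

/-- The complex outputs obtained from a finite sequence of channel outputs. -/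
def Modulation.mergeSeq (M : Modulation 𝕜 b) {n : ℕ} (y : Fin n → Fin k → 𝕜) (l : ℕ) :
    Fin k → ℂ :=
  fun j => ∑ t ∈ Finset.range b, M.merge t (extend y (b * l + t) j)

lemma Modulation.merge_zero (M : Modulation 𝕜 b) (t : ℕ) : M.merge t 0 = 0 := by
  have := M.merge_add t 0 0
  simpa using this

lemma Modulation.IsNoise.noiseForm_nonneg {M : Modulation 𝕜 b} {ν : Measure (Fin k → 𝕜)}
    {K : Matrix (Fin k) (Fin k) ℂ} (hν : M.IsNoise ν K) (v : Fin k → ℂ) : 0 ≤ noiseForm K v := by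
  have h := hν.second 0 M.pos v
  have hb : (0 : ℝ) < b := by exact_mod_cast M.pos
  have h1 : 0 ≤ (b : ℝ)⁻¹ * noiseForm K v := h ▸ integral_nonneg fun _ => by positivity
  exact nonneg_of_mul_nonneg_right h1 (inv_pos.2 hb)

/-- An inequality because blocks reaching beyond time `n` are padded with zeros, which can only
lower the second moment; no relation between `b * r` and `n` is needed. -/
lemma Modulation.IsNoise.lintegral_le {M : Modulation 𝕜 b} {ν : Measure (Fin k → 𝕜)}
    {K : Matrix (Fin k) (Fin k) ℂ} (hν : M.IsNoise ν K) (n r : ℕ) (u : ℕ → Fin k → ℂ) (c : ℂ) :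
    ∫⁻ z, ‖c + ∑ l ∈ Finset.range r, u l ⬝ᵥ M.mergeSeq z l‖ₑ ^ 2
        ∂(Measure.pi fun _ : Fin n => ν) ≤
      ENNReal.ofReal (‖c‖ ^ 2 + ∑ l ∈ Finset.range r, noiseForm K (u l)) := by
  have := hν.isProbabilityMeasure
  have hb : (b : ℝ) ≠ 0 := by exact_mod_cast M.pos.ne'
  -- Time `i` is use `i % b` of block `i / b`, so the blockwise sum becomes a sum of independent
  -- terms over single channel uses.
  set g : ℕ → (Fin k → 𝕜) → ℂ := fun i x => ∑ j, u (i / b) j * M.merge (i % b) (x j) with hg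
  have hsum (z : Fin n → Fin k → 𝕜) : ∑ l ∈ Finset.range r, u l ⬝ᵥ M.mergeSeq z l =
      ∑ i : Fin n, if (i : ℕ) < b * r then g i (z i) else 0 := by
    rw [← sum_range_extend g (fun i => by simp [hg, M.merge_zero]), sum_range_mul_eq]
    refine Finset.sum_congr rfl fun l _ => ?_
    simp only [dotProduct, Modulation.mergeSeq, Finset.mul_sum]
    rw [Finset.sum_comm]
    refine Finset.sum_congr rfl fun t ht => ?_
    have ht := Finset.mem_range.1 ht
    simp only [hg, Nat.mul_add_div M.pos, Nat.div_eq_of_lt ht, Nat.mul_add_mod,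
      Nat.mod_eq_of_lt ht, add_zero]
  set g' : Fin n → (Fin k → 𝕜) → ℂ := fun i x => if (i : ℕ) < b * r then g i x else 0 with hg'
  have hmem (i : Fin n) : MemLp (g' i) 2 ν := by
    by_cases hi : (i : ℕ) < b * r
    · simpa only [hg', hi, if_true] using hν.memLp _ _
    · simp [hg', hi]
  have hmean (i : Fin n) : ∫ x, g' i x ∂ν = 0 := by
    by_cases hi : (i : ℕ) < b * r
    · simpa only [hg', hi, if_true] using hν.mean _ _
    · simp [hg', hi]
  have hsq (i : Fin n) : ∫ x, ‖g' i x‖ ^ 2 ∂ν =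
      if (i : ℕ) < b * r then (b : ℝ)⁻¹ * noiseForm K (u (i / b)) else 0 := by
    by_cases hi : (i : ℕ) < b * r
    · simpa only [hg', hi, if_true] using hν.second _ (Nat.mod_lt _ M.pos) _
    · simp [hg', hi]
  simp only [hsum]
  rw [lintegral_enorm_sq_add_sum_pi hmem hmean]
  refine ENNReal.ofReal_le_ofReal ((add_le_add_iff_left _).2 ?_)
  simp only [hsq]
  have e : ∑ l ∈ Finset.range r, noiseForm K (u l) =
      ∑ i ∈ Finset.range (b * r), (b : ℝ)⁻¹ * noiseForm K (u (i / b)) := by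
    rw [sum_range_mul_eq]
    refine Finset.sum_congr rfl fun l _ => ?_
    have : ∀ t ∈ Finset.range b, (b : ℝ)⁻¹ * noiseForm K (u ((b * l + t) / b)) =
        (b : ℝ)⁻¹ * noiseForm K (u l) := by
      intro t ht
      rw [Nat.mul_add_div M.pos, Nat.div_eq_of_lt (Finset.mem_range.1 ht), add_zero]
    rw [Finset.sum_congr rfl this, Finset.sum_const, Finset.card_range, nsmul_eq_mul]
    field_simp
  rw [e, Finset.sum_fin_eq_sum_range
    (fun i : Fin n => if (i : ℕ) < b * r then (b : ℝ)⁻¹ * noiseForm K (u (i / b)) else 0)]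
  have hnn (i : ℕ) : 0 ≤ (b : ℝ)⁻¹ * noiseForm K (u (i / b)) :=
    mul_nonneg (by positivity) (hν.noiseForm_nonneg _)
  calc _ ≤ ∑ i ∈ Finset.range n,
        if i < b * r then (b : ℝ)⁻¹ * noiseForm K (u (i / b)) else 0 := by
        refine Finset.sum_le_sum fun i hi => ?_
        rw [dif_pos (Finset.mem_range.1 hi)]
    _ = ∑ i ∈ Finset.range n with i < b * r, (b : ℝ)⁻¹ * noiseForm K (u (i / b)) := by
        rw [Finset.sum_filter]
    _ ≤ _ := by
        refine Finset.sum_le_sum_of_subset_of_nonneg (fun i hi => ?_) fun i _ _ => hnn i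
        simp only [Finset.mem_filter, Finset.mem_range] at hi ⊢
        exact hi.2

lemma Modulation.IsNoise.lintegral_closedState_le {M : Modulation 𝕜 b}
    {ν : Measure (Fin k → 𝕜)} {K : Matrix (Fin k) (Fin k) ℂ} (hν : M.IsNoise ν K)
    (F : Matrix (Fin k) (Fin k) ℂ) (V x : Fin k → ℂ) (n r : ℕ) :
    ∫⁻ z, ‖x ⬝ᵥ closedState F V (M.mergeSeq z) r‖ₑ ^ 2 ∂(Measure.pi fun _ : Fin n => ν) ≤
      ENNReal.ofReal (stateForm F K V x r) := by
  have h := hν.lintegral_le n r (fun l => -(x ᵥ* F ^ (r - 1 - l))) (x ⬝ᵥ (F ^ r *ᵥ V))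
  simp only [neg_dotProduct, Finset.sum_neg_distrib, ← sub_eq_add_neg, noiseForm_neg,
    ← dotProduct_closedState] at h
  rwa [Finset.sum_range_reflect (fun s => noiseForm K (x ᵥ* F ^ s)) r] at h

end Modulation

/-! ### Gaussian noise -/

section Gaussian

variable {ι : Type} [Fintype ι] [DecidableEq ι] {S : Matrix ι ι ℝ}

lemma memLp_linear_gaussian (p : ι → ℝ) :
    MemLp (fun x : EuclideanSpace ℝ ι => ∑ i, p i * x i) 2
      (multivariateGaussian (0 : EuclideanSpace ℝ ι) S) := by
  refine memLp_finsetSum _ fun i _ => MemLp.const_mul ?_ _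
  exact (IsGaussian.memLp_two_id
    (μ := multivariateGaussian (0 : EuclideanSpace ℝ ι) S)).continuousLinearMap_comp
    (EuclideanSpace.proj (𝕜 := ℝ) i)

lemma integral_linear_gaussian (p : ι → ℝ) :
    ∫ x : EuclideanSpace ℝ ι, ∑ i, p i * x i
      ∂(multivariateGaussian (0 : EuclideanSpace ℝ ι) S) = 0 := by
  have h := ContinuousLinearMap.integral_comp_id_comm
    (μ := multivariateGaussian (0 : EuclideanSpace ℝ ι) S)
    IsGaussian.integrable_id
    (∑ i, p i • (EuclideanSpace.proj i : EuclideanSpace ℝ ι →L[ℝ] ℝ))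
  rw [integral_id_multivariateGaussian, map_zero] at h
  rw [← h]
  refine integral_congr_ae (.of_forall fun x => ?_)
  simp

lemma integral_linear_gaussian_sq (hS : S.PosSemidef) (p : ι → ℝ) :
    ∫ x : EuclideanSpace ℝ ι, (∑ i, p i * x i) ^ 2
      ∂(multivariateGaussian (0 : EuclideanSpace ℝ ι) S) = ∑ i, ∑ j, p i * S i j * p j := by
  have h := covarianceBilin_multivariateGaussian (μ := (0 : EuclideanSpace ℝ ι)) hS
    (WithLp.toLp 2 p) (WithLp.toLp 2 p)
  rw [covarianceBilin_apply_eq_cov IsGaussian.memLp_two_id] at h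
  have e : (fun u : EuclideanSpace ℝ ι => inner ℝ (WithLp.toLp 2 p) u) =
      fun u => ∑ i, p i * u i := by
    funext u
    simp [PiLp.inner_apply, mul_comm]
  rw [e, covariance_self (memLp_linear_gaussian p).aestronglyMeasurable.aemeasurable,
    variance_eq_sub (memLp_linear_gaussian p), integral_linear_gaussian] at h
  simp only [Pi.pow_apply, zero_pow two_ne_zero, sub_zero] at h
  rw [h]
  simp only [dotProduct, mulVec, Finset.mul_sum, mul_assoc]

lemma memLp_complex_linear_gaussian (p q : ι → ℝ) :
    MemLp (fun x : EuclideanSpace ℝ ι => (⟨∑ i, p i * x i, ∑ i, q i * x i⟩ : ℂ)) 2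
      (multivariateGaussian (0 : EuclideanSpace ℝ ι) S) := by
  have h := (memLp_linear_gaussian (S := S) p).ofReal (K := ℂ) |>.add
    (((memLp_linear_gaussian (S := S) q).ofReal (K := ℂ)).const_mul Complex.I)
  convert h using 1
  funext x
  apply Complex.ext <;> simp

lemma integral_complex_linear_gaussian (p q : ι → ℝ) :
    ∫ x : EuclideanSpace ℝ ι, (⟨∑ i, p i * x i, ∑ i, q i * x i⟩ : ℂ)
      ∂(multivariateGaussian (0 : EuclideanSpace ℝ ι) S) = 0 := by
  have hi := (memLp_complex_linear_gaussian (S := S) p q).integrable one_le_two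
  apply Complex.ext
  · have := integral_re (𝕜 := ℂ) hi
    simp only [RCLike.re_eq_complex_re] at this
    rw [← this, integral_linear_gaussian, Complex.zero_re]
  · have := integral_im (𝕜 := ℂ) hi
    simp only [RCLike.im_eq_complex_im] at this
    rw [← this, integral_linear_gaussian, Complex.zero_im]

lemma integral_norm_complex_linear_gaussian_sq (hS : S.PosSemidef) (p q : ι → ℝ) :
    ∫ x : EuclideanSpace ℝ ι, ‖(⟨∑ i, p i * x i, ∑ i, q i * x i⟩ : ℂ)‖ ^ 2
      ∂(multivariateGaussian (0 : EuclideanSpace ℝ ι) S) =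
      ∑ i, ∑ j, p i * S i j * p j + ∑ i, ∑ j, q i * S i j * q j := by
  rw [integral_norm_sq_eq (memLp_complex_linear_gaussian p q), integral_linear_gaussian_sq hS,
    integral_linear_gaussian_sq hS]

end Gaussian

/-! ### The two modulations and their Gaussian noise laws -/

section Noise

variable {k : ℕ}

/-- A complex symbol is one symbol of the complex channel. -/
def complexModulation : Modulation ℂ 1 where
  split _ x := x
  merge _ x := x
  pos := one_pos
  measurable_split _ := measurable_id
  measurable_merge _ := measurable_id
  merge_add _ _ _ := rfl
  merge_split x := by simp
  norm_split x := by simp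

/-- The real and imaginary parts of a complex symbol, scaled by `√2`, are sent in two uses of the
real channel. -/
noncomputable def realModulation : Modulation ℝ 2 where
  split t x := √2 * if t = 0 then x.re else x.im
  merge t x := (√2 : ℂ)⁻¹ * (if t = 0 then 1 else Complex.I) * (x : ℂ)
  pos := two_pos
  measurable_split t := by
    split_ifs
    · exact Complex.measurable_re.const_mul _
    · exact Complex.measurable_im.const_mul _
  measurable_merge t := Complex.measurable_ofReal.const_mul _
  merge_add t x y := by
    push_cast
    ring
  merge_split x := by
    have h : (√2 : ℂ) ≠ 0 := by
      exact_mod_cast (Real.sqrt_pos.2 two_pos).ne'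
    simp only [Finset.sum_range_succ, Finset.sum_range_zero, if_true, one_ne_zero, if_false]
    conv_rhs => rw [← Complex.re_add_im x]
    push_cast
    field_simp
    ring
  norm_split x := by
    have h : √2 ^ 2 = (2 : ℝ) := Real.sq_sqrt two_pos.le
    simp only [Finset.sum_range_succ, Finset.sum_range_zero, if_true, one_ne_zero, if_false,
      Real.norm_eq_abs, sq_abs, mul_pow, h]
    rw [← Complex.normSq_eq_norm_sq, Complex.normSq_apply]
    push_cast
    ring

/-- The covariance matrix of the real and imaginary parts of a `CN(0, K)` vector. -/
noncomputable def blockCov (K : Matrix (Fin k) (Fin k) ℂ) :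
    Matrix (Fin k ⊕ Fin k) (Fin k ⊕ Fin k) ℝ :=
  (1 / 2 : ℝ) • Matrix.fromBlocks (K.map Complex.re) (-K.map Complex.im)
    (K.map Complex.im) (K.map Complex.re)

lemma blockCov_form (K : Matrix (Fin k) (Fin k) ℂ) (p q : Fin k → ℝ) :
    ∑ i, ∑ j, Sum.elim p q i * blockCov K i j * Sum.elim p q j =
      1 / 2 * ∑ i, ∑ j, ((K i j).re * (p i * p j + q i * q j) +
        (K i j).im * (q i * p j - p i * q j)) := by
  simp only [Fintype.sum_sum_type, Sum.elim_inl, Sum.elim_inr, blockCov, Matrix.smul_apply,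
    Matrix.fromBlocks_apply₁₁, Matrix.fromBlocks_apply₁₂, Matrix.fromBlocks_apply₂₁,
    Matrix.fromBlocks_apply₂₂, Matrix.map_apply, Matrix.neg_apply, smul_eq_mul,
    ← Finset.sum_add_distrib, Finset.mul_sum]
  refine Finset.sum_congr rfl fun i _ => Finset.sum_congr rfl fun j _ => by ring

/-- The form at `(u, v)` is half the real part of the Hermitian form of `K` at `u + √-1 v`. -/
lemma blockCov_posSemidef {K : Matrix (Fin k) (Fin k) ℂ} (hK : K.PosSemidef) :
    (blockCov K).PosSemidef := by
  refine Matrix.PosSemidef.of_dotProduct_mulVec_nonneg ?_ fun x => ?_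
  · have h (i j : Fin k) : star (K j i) = K i j := hK.isHermitian.apply i j
    have hre (i j : Fin k) : (K j i).re = (K i j).re := by rw [← h i j]; simp
    have him (i j : Fin k) : (K j i).im = -(K i j).im := by rw [← h i j]; simp
    ext (i | i) (j | j) <;> simp [blockCov, Matrix.conjTranspose_apply, hre i j, him i j]
  · have h := (Complex.le_def.1 (hK.dotProduct_mulVec_nonneg
      (fun i => (⟨x (Sum.inl i), x (Sum.inr i)⟩ : ℂ)))).1
    have e := blockCov_form K (x ∘ Sum.inl) (x ∘ Sum.inr)
    rw [Sum.elim_comp_inl_inr] at e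
    simp only [dotProduct, mulVec, Finset.mul_sum, Pi.star_apply, star_trivial, ← mul_assoc] at h ⊢
    rw [e]
    refine mul_nonneg (by norm_num) (h.trans (le_of_eq ?_))
    simp only [Complex.re_sum]
    refine Finset.sum_congr rfl fun i _ => Finset.sum_congr rfl fun j _ => ?_
    simp
    ring

lemma noiseForm_eq (K : Matrix (Fin k) (Fin k) ℂ) (v : Fin k → ℂ) :
    noiseForm K v = ∑ i, ∑ j, ((K i j).re * ((v i).re * (v j).re + (v i).im * (v j).im) +
      (K i j).im * ((v i).re * (v j).im - (v i).im * (v j).re)) := by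
  simp only [noiseForm, Complex.re_sum]
  refine Finset.sum_congr rfl fun i _ => Finset.sum_congr rfl fun j _ => ?_
  simp
  ring

lemma measurable_linear (v : Fin k → ℂ) : Measurable fun z : Fin k → ℂ => ∑ j, v j * z j := by
  fun_prop

/-- The real and imaginary parts of `v · Z` are real linear functionals of the underlying Gaussian
vector, with coefficients `(Re v, -Im v)` and `(Im v, Re v)`. Their variances add up to `noiseForm K
v`. -/
lemma isNoise_complexNoise {K : Matrix (Fin k) (Fin k) ℂ} (hK : K.PosSemidef) :
    complexModulation.IsNoise (complexNoise K) K := by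
  set f : EuclideanSpace ℝ (Fin k ⊕ Fin k) → Fin k → ℂ :=
    fun x i => (⟨x (Sum.inl i), x (Sum.inr i)⟩ : ℂ) with hf
  have hfm : Measurable f := by
    refine measurable_pi_lambda _ fun i => ?_
    have : (fun x : EuclideanSpace ℝ (Fin k ⊕ Fin k) => f x i) =
        fun x => (x (Sum.inl i) : ℂ) + (x (Sum.inr i) : ℂ) * Complex.I := by
      funext x
      apply Complex.ext <;> simp [hf]
    rw [this]
    fun_prop
  have hlaw : complexNoise K = (multivariateGaussian 0 (blockCov K)).map f := rfl
  have hlin (v : Fin k → ℂ) (x : EuclideanSpace ℝ (Fin k ⊕ Fin k)) :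
      ∑ j, v j * f x j =
        (⟨∑ i, Sum.elim (fun i => (v i).re) (fun i => -(v i).im) i * x i,
          ∑ i, Sum.elim (fun i => (v i).im) (fun i => (v i).re) i * x i⟩ : ℂ) := by
    apply Complex.ext
    · simp only [Complex.re_sum, Fintype.sum_sum_type, Sum.elim_inl, Sum.elim_inr,
        ← Finset.sum_add_distrib, Complex.mul_re, hf]
      exact Finset.sum_congr rfl fun i _ => by ring
    · simp only [Complex.im_sum, Fintype.sum_sum_type, Sum.elim_inl, Sum.elim_inr,
        ← Finset.sum_add_distrib, Complex.mul_im, hf]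
      exact Finset.sum_congr rfl fun i _ => by ring
  rw [hlaw]
  refine ⟨Measure.isProbabilityMeasure_map hfm.aemeasurable, fun t v => ?_, fun t v => ?_,
    fun t _ v => ?_⟩
  · change MemLp (fun z : Fin k → ℂ => ∑ j, v j * z j) 2 _
    rw [memLp_map_measure_iff (measurable_linear v).aestronglyMeasurable hfm.aemeasurable]
    exact (memLp_complex_linear_gaussian _ _).ae_eq (.of_forall fun x => (hlin v x).symm)
  · change ∫ z : Fin k → ℂ, ∑ j, v j * z j ∂_ = 0
    rw [integral_map hfm.aemeasurable (measurable_linear v).aestronglyMeasurable]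
    simp only [hlin]
    exact integral_complex_linear_gaussian _ _
  · change ∫ z : Fin k → ℂ, ‖∑ j, v j * z j‖ ^ 2 ∂_ = _
    rw [integral_map hfm.aemeasurable
      ((measurable_linear v).norm.pow_const 2).aestronglyMeasurable]
    simp only [hlin]
    rw [integral_norm_complex_linear_gaussian_sq (blockCov_posSemidef hK), blockCov_form,
      blockCov_form, noiseForm_eq, ← mul_add, ← Finset.sum_add_distrib]
    simp only [← Finset.sum_add_distrib, Finset.mul_sum]
    refine Finset.sum_congr rfl fun i _ => Finset.sum_congr rfl fun j _ => ?_
    push_cast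
    ring

/-- Each real use enters the merged noise with a complex factor of squared modulus `1/2`, and so
carries half of the second moment prescribed by `K`. -/
lemma isNoise_realNoise {K : Matrix (Fin k) (Fin k) ℝ}
    (hK : (K.map (fun x : ℝ => (x : ℂ))).PosSemidef) :
    realModulation.IsNoise (realNoise K) (K.map (fun x : ℝ => (x : ℂ))) := by
  have hKr : K.PosSemidef := by
    refine Matrix.PosSemidef.of_dotProduct_mulVec_nonneg ?_ fun x => ?_
    · ext i j
      have := hK.isHermitian.apply i j
      simpa using this
    · have h := (Complex.le_def.1 (hK.dotProduct_mulVec_nonneg (fun i => (x i : ℂ)))).1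
      simpa [dotProduct, mulVec, Complex.re_sum] using h
  set f : EuclideanSpace ℝ (Fin k) → Fin k → ℝ := fun x i => x i with hf
  have hfm : Measurable f := by fun_prop
  have hlaw : realNoise K = (multivariateGaussian 0 K).map f := rfl
  set c : ℕ → ℂ := fun t => (√2 : ℂ)⁻¹ * (if t = 0 then 1 else Complex.I) with hc
  have hc2 (t : ℕ) : (c t).re ^ 2 + (c t).im ^ 2 = 1 / 2 := by
    have h : √2 ^ 2 = (2 : ℝ) := Real.sq_sqrt two_pos.le
    have : ‖c t‖ ^ 2 = 1 / 2 := by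
      simp only [hc, norm_mul, norm_inv, Complex.norm_real, Real.norm_eq_abs, mul_pow, inv_pow,
        sq_abs, h]
      split_ifs <;> simp
    rw [← this, ← Complex.normSq_eq_norm_sq, Complex.normSq_apply]
    ring
  have hlin (t : ℕ) (v : Fin k → ℂ) (x : EuclideanSpace ℝ (Fin k)) :
      ∑ j, v j * (c t * (f x j : ℂ)) =
        (⟨∑ i, (v i * c t).re * x i, ∑ i, (v i * c t).im * x i⟩ : ℂ) := by
    apply Complex.ext
    · simp only [Complex.re_sum, ← mul_assoc, Complex.re_mul_ofReal, hf]
    · simp only [Complex.im_sum, ← mul_assoc, Complex.im_mul_ofReal, hf]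
  have hm (t : ℕ) (v : Fin k → ℂ) :
      Measurable fun z : Fin k → ℝ => ∑ j, v j * (c t * (z j : ℂ)) := by fun_prop
  rw [hlaw]
  refine ⟨Measure.isProbabilityMeasure_map hfm.aemeasurable, fun t v => ?_, fun t v => ?_,
    fun t _ v => ?_⟩
  · change MemLp (fun z : Fin k → ℝ => ∑ j, v j * (c t * (z j : ℂ))) 2 _
    rw [memLp_map_measure_iff (hm t v).aestronglyMeasurable hfm.aemeasurable]
    exact (memLp_complex_linear_gaussian _ _).ae_eq (.of_forall fun x => (hlin t v x).symm)
  · change ∫ z : Fin k → ℝ, ∑ j, v j * (c t * (z j : ℂ)) ∂_ = 0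
    rw [integral_map hfm.aemeasurable (hm t v).aestronglyMeasurable]
    simp only [hlin]
    exact integral_complex_linear_gaussian _ _
  · change ∫ z : Fin k → ℝ, ‖∑ j, v j * (c t * (z j : ℂ))‖ ^ 2 ∂_ = _
    rw [integral_map hfm.aemeasurable ((hm t v).norm.pow_const 2).aestronglyMeasurable]
    simp only [hlin]
    rw [integral_norm_complex_linear_gaussian_sq hKr, noiseForm_eq, ← Finset.sum_add_distrib]
    simp only [← Finset.sum_add_distrib, Finset.mul_sum]
    refine Finset.sum_congr rfl fun i _ => Finset.sum_congr rfl fun j _ => ?_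
    simp only [Matrix.map_apply, Complex.ofReal_re, Complex.ofReal_im, Complex.mul_re,
      Complex.mul_im]
    push_cast
    linear_combination (K i j * ((v i).re * (v j).re + (v i).im * (v j).im)) * hc2 t

end Noise

/-! ### Constellations -/

section Constellation

/-- A `q × q` grid of step `L / q` with `q = ⌈B⌉`, the point of index `m` having coordinates given
by `m % q` and `m / q`. The bound `q ≤ 2B` uses `B ≥ 1`. -/
lemma exists_constellation {N : ℕ} {L B : ℝ} (hL : 0 ≤ L) (hB : 1 ≤ B) (hN : (N : ℝ) ≤ B ^ 2) :
    ∃ φ : Fin N → ℂ, (∀ m, ‖φ m‖ ≤ 2 * L) ∧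
      ∀ m m', m ≠ m' → L / (2 * B) ≤ ‖φ m - φ m'‖ := by
  set q := ⌈B⌉₊ with hq
  have hBq : B ≤ q := Nat.le_ceil B
  have hq0 : (0 : ℝ) < q := by linarith
  have hq0' : 0 < q := by exact_mod_cast hq0
  have hq2 : (q : ℝ) ≤ 2 * B := by
    have := Nat.ceil_lt_add_one (zero_le_one.trans hB)
    linarith
  have hNq : N ≤ q * q := by
    have : (N : ℝ) ≤ q * q := by nlinarith
    exact_mod_cast this
  have hstep : L / (2 * B) ≤ L / q := div_le_div_of_nonneg_left hL hq0 hq2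
  have hint {s t : ℕ} (h : s ≠ t) : L / q ≤ |L / q * s - L / q * t| := by
    rw [← mul_sub, abs_mul, abs_of_nonneg (div_nonneg hL hq0.le)]
    refine le_mul_of_one_le_right (div_nonneg hL hq0.le) ?_
    have : (1 : ℤ) ≤ |(s : ℤ) - t| := Int.one_le_abs (by omega)
    exact_mod_cast this
  refine ⟨fun m => ⟨L / q * (m % q : ℕ), L / q * (m / q : ℕ)⟩, fun m => ?_, fun m m' h => ?_⟩
  · refine (Complex.norm_le_abs_re_add_abs_im _).trans ?_
    have h1 : ((m % q : ℕ) : ℝ) ≤ q := by exact_mod_cast (Nat.mod_lt _ hq0').le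
    have h2 : ((m / q : ℕ) : ℝ) ≤ q := by
      exact_mod_cast (Nat.div_lt_of_lt_mul (m.2.trans_le hNq)).le
    have h3 (x : ℕ) (hx : (x : ℝ) ≤ q) : |L / q * x| ≤ L := by
      rw [abs_of_nonneg (by positivity)]
      calc L / q * x ≤ L / q * q := by gcongr
        _ = L := by field_simp
    have := h3 _ h1
    have := h3 _ h2
    dsimp only
    linarith
  · refine hstep.trans ?_
    by_cases hmod : (m : ℕ) % q = m' % q
    · have hdiv : (m : ℕ) / q ≠ m' / q := by
        intro hdiv
        apply h
        ext
        rw [← Nat.div_add_mod (m : ℕ) q, ← Nat.div_add_mod (m' : ℕ) q, hmod, hdiv]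
      refine (hint hdiv).trans ?_
      refine le_trans (le_of_eq ?_) (Complex.abs_im_le_norm _)
      rw [Complex.sub_im]
    · refine (hint hmod).trans ?_
      refine le_trans (le_of_eq ?_) (Complex.abs_re_le_norm _)
      rw [Complex.sub_re]

/-- The balls of radius `δ / 2` around the points are disjoint, so a map constant on each of them
extends measurably. -/
lemma exists_decoder {N : ℕ} [Nonempty (Fin N)] {φ : Fin N → ℂ} {δ : ℝ}
    (hφ : ∀ m m', m ≠ m' → δ ≤ ‖φ m - φ m'‖) :
    ∃ dec : ℂ → Fin N, Measurable dec ∧ ∀ w m, ‖w - φ m‖ < δ / 2 → dec w = m := by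
  obtain ⟨f, hf, h⟩ := exists_measurable_piecewise (fun m => Metric.ball (φ m) (δ / 2))
    (fun m => measurableSet_ball) (fun m (_ : ℂ) => m) (fun m => measurable_const)
    (fun m m' hm w hw => by
      exfalso
      have h1 := hφ m m' hm
      have h2 := mem_ball_iff_norm.1 hw.1
      have h3 := mem_ball_iff_norm.1 hw.2
      have h4 := norm_sub_le_norm_sub_add_norm_sub (φ m) w (φ m')
      rw [norm_sub_rev (φ m) w] at h4
      linarith)
  exact ⟨f, hf, fun w m hw => h m (mem_ball_iff_norm.2 hw)⟩

lemma numMessages_pos (n : ℕ) (R : ℝ) : 0 < numMessages n R :=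
  Nat.ceil_pos.2 (Real.rpow_pos_of_pos two_pos _)

/-- The factor `2x` absorbs both the rounding up and the extra `+ 1` in the exponent, which arises
when the last block is incomplete. -/
lemma numMessages_logb_le {x : ℝ} (hx : 1 < x) {n m : ℕ} (h : n ≤ 2 * m + 1) :
    (numMessages n (Real.logb 2 x) : ℝ) ≤ (2 * x * x ^ m) ^ 2 := by
  have h1 : (2 : ℝ) ^ ((n : ℝ) * Real.logb 2 x) = x ^ n := by
    rw [mul_comm, Real.rpow_mul two_pos.le, Real.rpow_logb two_pos (by norm_num) (by linarith),
      Real.rpow_natCast]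
  have h2 : (numMessages n (Real.logb 2 x) : ℝ) ≤ x ^ n + 1 := by
    rw [numMessages, h1]
    exact (Nat.ceil_lt_add_one (by positivity)).le
  have h3 : x ^ n ≤ x ^ (2 * m + 1) := pow_le_pow_right₀ hx.le h
  have h4 : 1 ≤ x ^ (2 * m) := one_le_pow₀ hx.le
  have h5 : (2 * x * x ^ m) ^ 2 = 4 * x ^ 2 * x ^ (2 * m) := by ring
  rw [pow_succ] at h3
  rw [h5]
  nlinarith [mul_pos (zero_lt_one.trans hx) (zero_lt_one.trans_le h4)]

end Constellation

/-! ### The feedback code -/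

section FeedbackCode

variable {𝕜 : Type} [MeasurableSpace 𝕜] [NormedRing 𝕜] {k b : ℕ}

/-- The states of the system `S_{l+1} = A S_l - y_l` with initial state `V`. -/
def openState (a V : Fin k → ℂ) (y : ℕ → Fin k → ℂ) : ℕ → Fin k → ℂ
  | 0 => V
  | l + 1 => fun j => a j * openState a V y l j - y l j

/-- This is what makes decoding local: coordinate `j` of the state involves only `V j` and the
outputs of receiver `j`, and division by `a j ^ r` leaves `V j` minus a statistic available to that
receiver. -/
lemma openState_apply {a : Fin k → ℂ} {j : Fin k} (ha : a j ≠ 0) (V : Fin k → ℂ)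
    (y : ℕ → Fin k → ℂ) (r : ℕ) :
    openState a V y r j =
      a j ^ r * (V j - ∑ l ∈ Finset.range r, (a j)⁻¹ ^ (l + 1) * y l j) := by
  induction r with
  | zero => simp [openState]
  | succ r ih =>
    have h : a j ^ (r + 1) * (a j)⁻¹ ^ (r + 1) = 1 := by
      rw [← mul_pow, mul_inv_cancel₀ ha, one_pow]
    simp only [openState]
    rw [ih, Finset.sum_range_succ]
    linear_combination y r j * h

/-- Substituting `y = BCS + w` in `S ↦ AS - y` gives `S ↦ (A - BC)S - w`. -/
lemma openState_eq_closedState {a : Fin k → ℂ} {G : Matrix (Fin k) (Fin k) ℂ} {V : Fin k → ℂ}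
    {y w : ℕ → Fin k → ℂ} {r : ℕ}
    (h : ∀ l < r, ∀ j,
      y l j = gainC a G 0 ⬝ᵥ closedState (closedLoop a G) V w l + w l j) :
    openState a V y r = closedState (closedLoop a G) V w r := by
  induction r with
  | zero => rfl
  | succ r ih =>
    funext j
    simp only [openState, closedState]
    rw [ih fun l hl => h l (hl.trans r.lt_succ_self), h r r.lt_succ_self, Pi.sub_apply]
    have : (closedLoop a G *ᵥ closedState (closedLoop a G) V w r) j =
        a j * closedState (closedLoop a G) V w r j -
          gainC a G 0 ⬝ᵥ closedState (closedLoop a G) V w r := by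
      conv_lhs => rw [closedLoop, Matrix.sub_mulVec, matA, ← Matrix.mulVec_mulVec]
      rw [Pi.sub_apply, Matrix.mulVec_diagonal]
      simp [matB, mulVec, dotProduct, closedLoop, matA]
    rw [this]
    ring

lemma measurable_extend (n i : ℕ) (j : Fin k) :
    Measurable fun y : Fin n → Fin k → 𝕜 => extend y i j := by
  by_cases h : i < n
  · simp only [extend, dif_pos h]
    fun_prop
  · simp only [extend, dif_neg h]
    exact measurable_const

lemma Modulation.measurable_mergeSeq (M : Modulation 𝕜 b) (n l : ℕ) (j : Fin k) :
    Measurable fun y : Fin n → Fin k → 𝕜 => M.mergeSeq y l j :=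
  Finset.measurable_fun_sum _ fun t _ => (M.measurable_merge t).comp (measurable_extend n _ j)

lemma measurable_openState {Ω : Type} [MeasurableSpace Ω] (a V : Fin k → ℂ)
    {y : Ω → ℕ → Fin k → ℂ} (hy : ∀ l j, Measurable fun ω => y ω l j) (r : ℕ) (j : Fin k) :
    Measurable fun ω => openState a V (y ω) r j := by
  induction r generalizing j with
  | zero => exact measurable_const
  | succ r ih => exact ((ih j).const_mul _).sub (hy r j)

lemma measurable_closedState {Ω : Type} [MeasurableSpace Ω] (F : Matrix (Fin k) (Fin k) ℂ)
    {V : Ω → Fin k → ℂ} (hV : ∀ j, Measurable fun ω => V ω j)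
    {w : Ω → ℕ → Fin k → ℂ} (hw : ∀ l j, Measurable fun ω => w ω l j) (r : ℕ) (j : Fin k) :
    Measurable fun ω => closedState F (V ω) (w ω) r j := by
  induction r generalizing j with
  | zero => exact hV j
  | succ r ih =>
    simp only [closedState, Pi.sub_apply, mulVec, dotProduct]
    exact (Finset.measurable_fun_sum _ fun i _ => (ih i).const_mul _).sub (hw r j)

/-- The code in which the complex symbols are the controls of the open-loop system whose initial
state is determined by the messages. -/
noncomputable def Modulation.feedbackCode (M : Modulation 𝕜 b) (n : ℕ) {N : Fin k → ℕ}
    (a C : Fin k → ℂ) (φ : (j : Fin k) → Fin (N j) → ℂ) (D : (j : Fin k) → ℂ → Fin (N j))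
    (hD : ∀ j, Measurable (D j)) : Code 𝕜 k n N where
  enc i m y := M.split (i % b)
    (C ⬝ᵥ openState a (fun j => φ j (m j)) (M.mergeSeq y) (i / b))
  dec j y := D j (∑ l ∈ Finset.range (n / b),
    (a j)⁻¹ ^ (l + 1) * M.mergeSeq (fun i (_ : Fin k) => y i) l j)
  measurable_enc i m := by
    refine (M.measurable_split _).comp ?_
    simp only [dotProduct]
    exact Finset.measurable_fun_sum _ fun j _ => (measurable_openState a _
      (fun l j => M.measurable_mergeSeq i l j) _ j).const_mul _
  measurable_dec j := by
    refine (hD j).comp (Finset.measurable_fun_sum _ fun l _ => Measurable.const_mul ?_ _)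
    exact (M.measurable_mergeSeq n l j).comp
      (measurable_pi_lambda _ fun i => measurable_pi_lambda _ fun _ => measurable_pi_apply i)

/-- For `l < N / b` the whole block `l` lies before time `N`, so merging recovers the complex symbol
plus merged noise. The encoder at time `N` reads only such complete blocks. -/
lemma Modulation.mergeSeq_eq (M : Modulation 𝕜 b) {n N : ℕ} (hN : N ≤ n)
    {y : Fin N → Fin k → 𝕜} {z : Fin n → Fin k → 𝕜} {X : ℕ → ℂ} {j : Fin k}
    (h : ∀ i : Fin N, y i j = M.split (i % b) (X (i / b)) + z ⟨i, i.2.trans_le hN⟩ j)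
    {l : ℕ} (hl : l < N / b) : M.mergeSeq y l j = X l + M.mergeSeq z l j := by
  rw [Modulation.mergeSeq, Modulation.mergeSeq, ← M.merge_split (X l), ← Finset.sum_add_distrib]
  refine Finset.sum_congr rfl fun t ht => ?_
  have ht := Finset.mem_range.1 ht
  have hi : b * l + t < N := by
    have h1 : b * (l + 1) ≤ b * (N / b) := Nat.mul_le_mul_left b hl
    have h2 := Nat.mul_div_le N b
    rw [Nat.mul_succ] at h1
    omega
  have h3 := h ⟨b * l + t, hi⟩
  simp only [Nat.mul_add_div M.pos, Nat.div_eq_of_lt ht, Nat.mul_add_mod,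
    Nat.mod_eq_of_lt ht, add_zero] at h3
  rw [extend, extend, dif_pos hi, dif_pos (hi.trans_le hN), h3, M.merge_add]

lemma Code.output_apply {n : ℕ} {N : Fin k → ℕ} (c : Code 𝕜 k n N) (m : (j : Fin k) → Fin (N j))
    (z : Fin n → Fin k → 𝕜) (i : Fin n) (j : Fin k) :
    c.output m z i j = c.input m z i + z i j := by
  rw [Code.output, Code.input]

variable (M : Modulation 𝕜 b) {n : ℕ} {N : Fin k → ℕ} {a : Fin k → ℂ}
  {G : Matrix (Fin k) (Fin k) ℂ} {φ : (j : Fin k) → Fin (N j) → ℂ}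
  {D : (j : Fin k) → ℂ → Fin (N j)} (hD : ∀ j, Measurable (D j))
  (m : (j : Fin k) → Fin (N j)) (z : Fin n → Fin k → 𝕜)

/-- Strong induction on time: the outputs fed back so far already have the form complex control plus
noise, so the open-loop state computed by the encoder is the closed-loop state. -/
lemma Modulation.input_feedbackCode (i : Fin n) :
    (M.feedbackCode n a (gainC a G 0) φ D hD).input m z i = M.split (i % b)
      (gainC a G 0 ⬝ᵥ
        closedState (closedLoop a G) (fun j => φ j (m j)) (M.mergeSeq z) (i / b)) := by
  obtain ⟨i, hi⟩ := i
  induction i using Nat.strong_induction_on with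
  | _ i ih =>
    simp only [Code.input, Modulation.feedbackCode]
    congr 2
    refine openState_eq_closedState fun l hl j => ?_
    refine M.mergeSeq_eq hi.le (X := fun l => gainC a G 0 ⬝ᵥ
      closedState (closedLoop a G) (fun j => φ j (m j)) (M.mergeSeq z) l) (fun l => ?_) hl
    rw [← ih l l.2 (l.2.trans hi)]
    exact Code.output_apply _ m z _ j

/-- The statistic of receiver `j` differs from its constellation point by `a j ^ (-r)` times the
final state, where `r = n / b`. -/
lemma Modulation.estimate_feedbackCode {j : Fin k} (ha : a j ≠ 0) {δ : ℝ}
    (hφ : ∀ w m, ‖w - φ j m‖ < δ / 2 → D j w = m)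
    (h : ‖closedState (closedLoop a G) (fun j => φ j (m j)) (M.mergeSeq z) (n / b) j‖ <
      ‖a j‖ ^ (n / b) * (δ / 2)) :
    (M.feedbackCode n a (gainC a G 0) φ D hD).estimate m z j = m j := by
  set c := M.feedbackCode n a (gainC a G 0) φ D hD
  have hstate : openState a (fun j => φ j (m j)) (M.mergeSeq (c.output m z)) (n / b) =
      closedState (closedLoop a G) (fun j => φ j (m j)) (M.mergeSeq z) (n / b) := by
    refine openState_eq_closedState fun l hl j => ?_
    refine M.mergeSeq_eq le_rfl (X := fun l => gainC a G 0 ⬝ᵥ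
      closedState (closedLoop a G) (fun j => φ j (m j)) (M.mergeSeq z) l) (fun i => ?_) hl
    rw [Code.output_apply, M.input_feedbackCode hD m z i]
  apply hφ
  -- The decoder feeds its scalar outputs to every coordinate of `mergeSeq`, but only coordinate `j`
  -- is read.
  have e : ∑ l ∈ Finset.range (n / b), (a j)⁻¹ ^ (l + 1) *
      M.mergeSeq (fun i (_ : Fin k) => c.output m z i j) l j =
      ∑ l ∈ Finset.range (n / b), (a j)⁻¹ ^ (l + 1) * M.mergeSeq (c.output m z) l j := by
    refine Finset.sum_congr rfl fun l _ => ?_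
    congr 1
    refine Finset.sum_congr rfl fun t _ => ?_
    congr 1
    unfold extend
    split_ifs <;> rfl
  rw [e]
  rw [← hstate, openState_apply ha, norm_mul, norm_pow, norm_sub_rev] at h
  exact lt_of_mul_lt_mul_left h (by positivity)

end FeedbackCode

/-! ### Achievability -/

section Achievability

variable {𝕜 : Type} [MeasurableSpace 𝕜] {k b : ℕ}

lemma lintegral_jointLaw_le {n : ℕ} {N : Fin k → ℕ} (hN : ∀ j, 0 < N j)
    {ν : Measure (Fin k → 𝕜)} [IsProbabilityMeasure ν]
    {f : ((j : Fin k) → Fin (N j)) × (Fin n → Fin k → 𝕜) → ℝ≥0∞} {B : ℝ≥0∞}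
    (hf : ∀ m, ∫⁻ z, f (m, z) ∂(Measure.pi fun _ : Fin n => ν) ≤ B) :
    ∫⁻ ω, f ω ∂(jointLaw n N ν) ≤ B := by
  have (j : Fin k) : Nonempty (Fin (N j)) := ⟨⟨0, hN j⟩⟩
  refine (lintegral_prod_le f).trans ((lintegral_mono hf).trans ?_)
  rw [lintegral_const, measure_univ, mul_one]

variable [NormedRing 𝕜]

lemma Modulation.sum_enorm_split (M : Modulation 𝕜 b) (x : ℂ) :
    ∑ t ∈ Finset.range b, ‖M.split t x‖ₑ ^ 2 = b * ‖x‖ₑ ^ 2 := by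
  have h := congrArg ENNReal.ofReal (M.norm_split x)
  rw [ENNReal.ofReal_sum_of_nonneg fun _ _ => by positivity,
    ENNReal.ofReal_mul (by positivity), ENNReal.ofReal_natCast] at h
  simpa only [ENNReal.ofReal_pow (norm_nonneg _), ofReal_norm] using h

/-- The last, possibly incomplete block is charged in full, whence `n / b + 1` blocks. -/
lemma Modulation.sum_lintegral_split_le [OpensMeasurableSpace 𝕜] {Ω : Type} [MeasurableSpace Ω]
    (M : Modulation 𝕜 b) (μ : Measure Ω) {X : ℕ → Ω → ℂ} (hX : ∀ l, Measurable (X l)) (n : ℕ) :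
    ∑ i : Fin n, ∫⁻ ω, ‖M.split (i % b) (X (i / b) ω)‖ₑ ^ 2 ∂μ ≤
      ∑ l ∈ Finset.range (n / b + 1), b * ∫⁻ ω, ‖X l ω‖ₑ ^ 2 ∂μ := by
  rw [← Finset.sum_range fun i => ∫⁻ ω, ‖M.split (i % b) (X (i / b) ω)‖ₑ ^ 2 ∂μ]
  refine (Finset.sum_le_sum_of_subset
    (Finset.range_subset_range.2 (Nat.lt_mul_div_succ n M.pos).le)).trans (le_of_eq ?_)
  rw [sum_range_mul_eq]
  refine Finset.sum_congr rfl fun l _ => ?_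
  have hm (t : ℕ) : Measurable fun ω => ‖M.split t (X l ω)‖ₑ ^ 2 :=
    ((M.measurable_split t).comp (hX l)).enorm.pow_const 2
  rw [← lintegral_const_mul _ ((hX l).enorm.pow_const 2)]
  simp only [← M.sum_enorm_split]
  rw [lintegral_finsetSum _ fun t _ => hm t]
  refine Finset.sum_congr rfl fun t ht => ?_
  have ht := Finset.mem_range.1 ht
  rw [Nat.mul_add_div M.pos, Nat.div_eq_of_lt ht, Nat.mul_add_mod, Nat.mod_eq_of_lt ht, add_zero]

variable {M : Modulation 𝕜 b} {ν : Measure (Fin k → 𝕜)}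
  {a : Fin k → ℂ} {G K : Matrix (Fin k) (Fin k) ℂ} {n : ℕ} {N : Fin k → ℕ}
  {φ : (j : Fin k) → Fin (N j) → ℂ} {D : (j : Fin k) → ℂ → Fin (N j)}

lemma Modulation.measurable_codeState (M : Modulation 𝕜 b) (F : Matrix (Fin k) (Fin k) ℂ)
    (φ : (j : Fin k) → Fin (N j) → ℂ) (r : ℕ) (j : Fin k) :
    Measurable fun ω : ((j : Fin k) → Fin (N j)) × (Fin n → Fin k → 𝕜) =>
      closedState F (fun j => φ j (ω.1 j)) (M.mergeSeq ω.2) r j :=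
  measurable_closedState F
    (fun j => (Measurable.of_discrete (f := φ j)).comp
      ((measurable_pi_apply j).comp measurable_fst))
    (fun l j => (M.measurable_mergeSeq n l j).comp measurable_snd) r j

lemma Modulation.IsNoise.avgPower_le [OpensMeasurableSpace 𝕜] (hν : M.IsNoise ν K) (hN : ∀ j, 0 < N j)
    (hD : ∀ j, Measurable (D j)) {B : ℕ → ℝ}
    (hB : ∀ m : (j : Fin k) → Fin (N j), ∀ r,
      stateForm (closedLoop a G) K (fun j => φ j (m j)) (gainC a G 0) r ≤ B r)
    (hB0 : ∀ r, 0 ≤ B r) :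
    (M.feedbackCode n a (gainC a G 0) φ D hD).avgPower ν ≤
      (n : ℝ≥0∞)⁻¹ * ENNReal.ofReal (b * ∑ l ∈ Finset.range (n / b + 1), B l) := by
  have := hν.isProbabilityMeasure
  set X : ℕ → ((j : Fin k) → Fin (N j)) × (Fin n → Fin k → 𝕜) → ℂ := fun l ω =>
    gainC a G 0 ⬝ᵥ closedState (closedLoop a G) (fun j => φ j (ω.1 j)) (M.mergeSeq ω.2) l with hX
  have hXm (l : ℕ) : Measurable (X l) := by
    simp only [hX, dotProduct]
    exact Finset.measurable_fun_sum _ fun j _ => (M.measurable_codeState _ φ l j).const_mul _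
  have hpow (l : ℕ) : ∫⁻ ω, ‖X l ω‖ₑ ^ 2 ∂(jointLaw n N ν) ≤ ENNReal.ofReal (B l) := by
    refine lintegral_jointLaw_le hN fun m => ?_
    have h := hν.lintegral_closedState_le (closedLoop a G) (fun j => φ j (m j))
      (gainC a G 0) n l
    exact h.trans (ENNReal.ofReal_le_ofReal (hB m l))
  have hsum := M.sum_lintegral_split_le (jointLaw n N ν) hXm n
  rw [Code.avgPower]
  simp only [Modulation.input_feedbackCode]
  refine mul_le_mul_right (hsum.trans ?_) _
  rw [Finset.mul_sum, ENNReal.ofReal_sum_of_nonneg fun l _ =>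
    mul_nonneg (by positivity) (hB0 l)]
  refine Finset.sum_le_sum fun l _ => ?_
  rw [ENNReal.ofReal_mul (by positivity), ENNReal.ofReal_natCast]
  exact mul_le_mul_right (hpow l) _

lemma Modulation.IsNoise.errorProb_le (hν : M.IsNoise ν K) (hN : ∀ j, 0 < N j)
    (ha : ∀ j, a j ≠ 0) (hD : ∀ j, Measurable (D j)) {δ : Fin k → ℝ} (hδ : ∀ j, 0 < δ j)
    (hφ : ∀ j w m, ‖w - φ j m‖ < δ j / 2 → D j w = m) {B : ℝ}
    (hB : ∀ m : (j : Fin k) → Fin (N j), ∀ j,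
      stateForm (closedLoop a G) K (fun j => φ j (m j)) (Pi.single j 1) (n / b) ≤ B)
    (hB0 : 0 ≤ B) :
    (M.feedbackCode n a (gainC a G 0) φ D hD).errorProb ν ≤
      ENNReal.ofReal (∑ j, ((‖a j‖ ^ (n / b) * (δ j / 2))⁻¹) ^ 2 * B) := by
  have := hν.isProbabilityMeasure
  set S : ((j : Fin k) → Fin (N j)) × (Fin n → Fin k → 𝕜) → Fin k → ℂ := fun ω =>
    closedState (closedLoop a G) (fun j => φ j (ω.1 j)) (M.mergeSeq ω.2) (n / b) with hS
  have hSm (j : Fin k) : Measurable fun ω => S ω j := M.measurable_codeState _ φ _ j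
  set w : Fin k → ℝ := fun j => (‖a j‖ ^ (n / b) * (δ j / 2))⁻¹ with hw
  have hw0 (j : Fin k) : 0 < ‖a j‖ ^ (n / b) * (δ j / 2) :=
    mul_pos (pow_pos (norm_pos_iff.2 (ha j)) _) (half_pos (hδ j))
  have hmeas (j : Fin k) : Measurable fun ω => ENNReal.ofReal (w j ^ 2) * ‖S ω j‖ₑ ^ 2 :=
    ((hSm j).enorm.pow_const 2).const_mul _
  calc (M.feedbackCode n a (gainC a G 0) φ D hD).errorProb ν
      ≤ ∫⁻ ω, ∑ j, ENNReal.ofReal (w j ^ 2) * ‖S ω j‖ₑ ^ 2 ∂(jointLaw n N ν) := by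
        -- Chebyshev and the union bound in one stroke: on the error event some summand is at least
        -- 1.
        refine meas_le_lintegral₀ (Finset.measurable_fun_sum _ fun j _ => hmeas j).aemeasurable ?_
        rintro ω ⟨j, hj⟩
        have h1 : ‖a j‖ ^ (n / b) * (δ j / 2) ≤ ‖S ω j‖ := by
          by_contra! h
          exact hj (M.estimate_feedbackCode hD ω.1 ω.2 (ha j) (hφ j) h)
        have h2 : 1 ≤ ENNReal.ofReal (w j ^ 2) * ‖S ω j‖ₑ ^ 2 := by
          rw [← ofReal_norm, ← ENNReal.ofReal_pow (norm_nonneg _),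
            ← ENNReal.ofReal_mul (sq_nonneg _), ENNReal.one_le_ofReal, ← mul_pow]
          refine one_le_pow₀ ?_
          simp only [hw]
          rwa [inv_mul_eq_div, one_le_div (hw0 j)]
        exact h2.trans (Finset.single_le_sum
          (f := fun j => ENNReal.ofReal (w j ^ 2) * ‖S ω j‖ₑ ^ 2)
          (fun _ _ => zero_le) (Finset.mem_univ j))
    _ = ∑ j, ENNReal.ofReal (w j ^ 2) * ∫⁻ ω, ‖S ω j‖ₑ ^ 2 ∂(jointLaw n N ν) := by
        rw [lintegral_finsetSum _ fun j _ => hmeas j]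
        exact Finset.sum_congr rfl fun j _ => lintegral_const_mul _ ((hSm j).enorm.pow_const 2)
    _ ≤ ∑ j, ENNReal.ofReal (w j ^ 2 * B) := by
        refine Finset.sum_le_sum fun j _ => ?_
        rw [ENNReal.ofReal_mul (sq_nonneg _)]
        refine mul_le_mul_right (lintegral_jointLaw_le hN fun m => ?_) _
        have h := hν.lintegral_closedState_le (closedLoop a G) (fun j => φ j (m j))
          (Pi.single j 1) n (n / b)
        simp only [single_dotProduct, one_mul] at h
        exact h.trans (ENNReal.ofReal_le_ofReal (hB m j))
    _ = _ := by
        rw [ENNReal.ofReal_sum_of_nonneg fun j _ => mul_nonneg (sq_nonneg _) hB0]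

/-- The scale `L` of the constellation trades error probability against transient energy. As `d * b
= 2`, a block carries two real dimensions of rate on either channel, matching a planar
constellation. -/
lemma Modulation.IsNoise.exists_code [OpensMeasurableSpace 𝕜] (hν : M.IsNoise ν K) {d : ℕ} (hd : d * b = 2)
    (ha1 : ∀ j, 1 < ‖a j‖) (hG : G.PosDef) (h : IsRiccatiSolution a G) (hK : K.PosSemidef) :
    ∃ ρ c : ℝ, 0 ≤ ρ ∧ ρ < 1 ∧ 0 ≤ c ∧ ∀ (n : ℕ) (L : ℝ), 1 ≤ L →
      ∃ C : Code 𝕜 k n (fun j => numMessages (d * n) (Real.logb 2 ‖a j‖)),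
        C.errorProb ν ≤ ENNReal.ofReal (c * ((L ^ 2)⁻¹ + ρ ^ (n / b))) ∧
        C.avgPower ν ≤ (n : ℝ≥0∞)⁻¹ *
          ENNReal.ofReal ((n + b) * (G * K).trace.re + c * L ^ 2) := by
  obtain ⟨ρ, c, hρ0, hρ1, hc, hform⟩ := exists_stateForm_le ha1 hG h hK
  have hP : 0 ≤ (G * K).trace.re := (Complex.le_def.1 (trace_mul_nonneg hG.posSemidef hK)).1
  have hρpow (r : ℕ) (L : ℝ) : (ρ ^ r * (2 * L)) ^ 2 ≤ 4 * L ^ 2 * ρ ^ r := by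
    have h1 : ρ ^ r ≤ 1 := pow_le_one₀ hρ0 hρ1.le
    have h2 : 0 ≤ ρ ^ r := pow_nonneg hρ0 r
    have h3 : ρ ^ r * ρ ^ r ≤ ρ ^ r := mul_le_of_le_one_left h2 h1
    nlinarith [sq_nonneg L]
  have hgeo (r : ℕ) : ∑ s ∈ Finset.range r, ρ ^ s ≤ (1 - ρ)⁻¹ :=
    sum_le_hasSum _ (fun _ _ => by positivity) (hasSum_geometric_of_lt_one hρ0 hρ1)
  have hpos : 0 ≤ (1 - ρ)⁻¹ := inv_nonneg.2 (by linarith)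
  -- The first term serves the error bound, where `256 = 64 · 4`: the 64 is the squared inverse of
  -- (1/8), half the spacing after scaling, and the 4 comes from the radius `2L`. The second serves
  -- the transient power, a geometric series.
  refine ⟨ρ, ∑ j, 256 * ‖a j‖ ^ 2 * c + b * (4 * c * (1 - ρ)⁻¹), hρ0, hρ1, by positivity,
    fun n L hL => ?_⟩
  set m := n / b with hm
  -- The incomplete block has at most `b - 1` uses, hence contributes at most `d * (b - 1) = 2 - d ≤
  -- 1` to the exponent.
  have hdn : d * n ≤ 2 * m + 1 := by
    have h1 := Nat.div_add_mod n b
    have h2 := Nat.mod_lt n M.pos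
    rw [← hm] at h1
    have h3 : d * n = 2 * m + d * (n % b) := by
      conv_lhs => rw [← h1]
      rw [mul_add, ← mul_assoc, hd]
    have h4 : d * (n % b + 1) ≤ d * b := Nat.mul_le_mul_left d h2
    have h5 : d ≠ 0 := by
      rintro rfl
      simp at hd
    rw [mul_add] at h4
    omega
  set N : Fin k → ℕ := fun j => numMessages (d * n) (Real.logb 2 ‖a j‖)
  have hN (j : Fin k) : 0 < N j := numMessages_pos _ _
  have (j : Fin k) : Nonempty (Fin (N j)) := ⟨⟨0, hN j⟩⟩
  have hR (j : Fin k) : 1 ≤ 2 * ‖a j‖ * ‖a j‖ ^ m := by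
    have := one_le_pow₀ (n := m) (ha1 j).le
    nlinarith [ha1 j]
  choose φ hφ hsep using fun j =>
    exists_constellation (zero_le_one.trans hL) (hR j) (numMessages_logb_le (ha1 j) hdn)
  choose D hD hdec using fun j => exists_decoder (hsep j)
  have ha (j : Fin k) : a j ≠ 0 := norm_pos_iff.1 (zero_lt_one.trans (ha1 j))
  have hV (x : (j : Fin k) → Fin (N j)) := hform (fun j => φ j (x j)) (2 * L) fun j => hφ j (x j)
  refine ⟨M.feedbackCode n a (gainC a G 0) φ D hD, ?_, ?_⟩
  · refine (hν.errorProb_le hN ha hD (δ := fun j => L / (2 * (2 * ‖a j‖ * ‖a j‖ ^ m)))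
      (fun j => div_pos (by linarith) (by linarith [hR j])) hdec
      (fun x j => (hV x m).2 j) (by positivity)).trans (ENNReal.ofReal_le_ofReal ?_)
    have hL0 : L ≠ 0 := by positivity
    have hL2 : (L ^ 2)⁻¹ * L ^ 2 = 1 := inv_mul_cancel₀ (pow_ne_zero 2 hL0)
    have hρm := pow_nonneg hρ0 m
    have hLi : 0 ≤ (L ^ 2)⁻¹ := by positivity
    calc ∑ j, ((‖a j‖ ^ m * (L / (2 * (2 * ‖a j‖ * ‖a j‖ ^ m)) / 2))⁻¹) ^ 2 *
          (c + c * (ρ ^ m * (2 * L)) ^ 2)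
        ≤ ∑ j, 256 * ‖a j‖ ^ 2 * c * ((L ^ 2)⁻¹ + ρ ^ m) := by
          refine Finset.sum_le_sum fun j _ => ?_
          have hj : ‖a j‖ ≠ 0 := norm_ne_zero_iff.2 (ha j)
          have e : ((‖a j‖ ^ m * (L / (2 * (2 * ‖a j‖ * ‖a j‖ ^ m)) / 2))⁻¹) ^ 2 =
              64 * ‖a j‖ ^ 2 * (L ^ 2)⁻¹ := by
            field_simp
            ring
          rw [e]
          calc 64 * ‖a j‖ ^ 2 * (L ^ 2)⁻¹ * (c + c * (ρ ^ m * (2 * L)) ^ 2)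
              ≤ 64 * ‖a j‖ ^ 2 * (L ^ 2)⁻¹ * (c + c * (4 * L ^ 2 * ρ ^ m)) := by
                gcongr
                exact hρpow m L
            _ = 64 * ‖a j‖ ^ 2 * c * ((L ^ 2)⁻¹ + 4 * ρ ^ m) := by
                linear_combination 256 * ‖a j‖ ^ 2 * c * ρ ^ m * hL2
            _ ≤ 64 * ‖a j‖ ^ 2 * c * (4 * ((L ^ 2)⁻¹ + ρ ^ m)) := by
                gcongr
                linarith
            _ = _ := by ring
      _ ≤ _ := by
          rw [← Finset.sum_mul]
          gcongr
          exact le_add_of_nonneg_right (by positivity)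
  · refine (hν.avgPower_le hN hD (fun x r => (hV x r).1) (fun r => by positivity)).trans ?_
    refine mul_le_mul_right (ENNReal.ofReal_le_ofReal ?_) _
    rw [Finset.sum_add_distrib, Finset.sum_const, Finset.card_range, nsmul_eq_mul, mul_add]
    refine add_le_add ?_ ?_
    · rw [← mul_assoc]
      refine mul_le_mul_of_nonneg_right ?_ hP
      have : b * (m + 1) ≤ n + b := by
        have := Nat.mul_div_le n b
        rw [mul_add, mul_one, hm]
        omega
      exact_mod_cast this
    · calc (b : ℝ) * ∑ l ∈ Finset.range (m + 1), c * (ρ ^ l * (2 * L)) ^ 2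
          ≤ b * ∑ l ∈ Finset.range (m + 1), c * (4 * L ^ 2 * ρ ^ l) := by
            gcongr with l
            exact hρpow l L
        _ = b * (4 * c * ∑ l ∈ Finset.range (m + 1), ρ ^ l) * L ^ 2 := by
            simp only [Finset.mul_sum, Finset.sum_mul]
            exact Finset.sum_congr rfl fun l _ => by ring
        _ ≤ b * (4 * c * (1 - ρ)⁻¹) * L ^ 2 := by
            gcongr
            exact hgeo _
        _ ≤ _ := by
            gcongr
            exact le_add_of_nonneg_left (by positivity)

theorem Modulation.IsNoise.achievableOver [OpensMeasurableSpace 𝕜] (hν : M.IsNoise ν K) {d : ℕ} (hd : d * b = 2)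
    (ha1 : ∀ j, 1 < ‖a j‖) (hG : G.PosDef) (h : IsRiccatiSolution a G) (hK : K.PosSemidef)
    {P : ℝ≥0} (hP : (G * K).trace.re = P) :
    AchievableOver d ν (fun j => Real.logb 2 ‖a j‖) P := by
  obtain ⟨ρ, c, hρ0, hρ1, hc, hcode⟩ := hν.exists_code hd ha1 hG h hK
  have hsq (n : ℕ) : (√√((n : ℝ) + 1)) ^ 2 = √((n : ℝ) + 1) := Real.sq_sqrt (Real.sqrt_nonneg _)
  -- The scale is `L = (n + 1)^{1/4}`, so that `L → ∞` while `L² / n → 0`; the `+ 1` ensures `L ≥ 1`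
  -- also for `n = 0`.
  choose C hE hW using fun n : ℕ => hcode n (√√((n : ℝ) + 1)) (by
    have : (1 : ℝ) ≤ n + 1 := by simp
    rw [Real.one_le_sqrt, Real.one_le_sqrt]
    exact this)
  simp only [hsq, hP] at hE hW
  have hsqrt : Tendsto (fun n : ℕ => (√((n : ℝ) + 1))⁻¹) atTop (𝓝 0) :=
    tendsto_inv_atTop_zero.comp (Real.tendsto_sqrt_atTop.comp
      (tendsto_atTop_add_const_right _ _ tendsto_natCast_atTop_atTop))
  refine ⟨C, ?_, ?_⟩
  · refine tendsto_of_tendsto_of_tendsto_of_le_of_le tendsto_const_nhds ?_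
      (fun _ => zero_le) hE
    have h1 : Tendsto (fun n : ℕ => ρ ^ (n / b)) atTop (𝓝 0) :=
      (tendsto_pow_atTop_nhds_zero_of_lt_one hρ0 hρ1).comp
        (Nat.tendsto_div_const_atTop M.pos.ne')
    have h2 := (hsqrt.add h1).const_mul c
    rw [add_zero, mul_zero] at h2
    simpa using ENNReal.tendsto_ofReal h2
  · have hinv : Tendsto (fun n : ℕ => ((n : ℝ))⁻¹) atTop (𝓝 0) :=
      tendsto_inv_atTop_zero.comp tendsto_natCast_atTop_atTop
    have hlim : Tendsto (fun n : ℕ => (P : ℝ) + (n : ℝ)⁻¹ * (b * P) +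
        c * ((√((n : ℝ) + 1))⁻¹ + (n : ℝ)⁻¹ * (√((n : ℝ) + 1))⁻¹)) atTop (𝓝 (P : ℝ)) := by
      have := ((tendsto_const_nhds (x := (P : ℝ))).add (hinv.mul_const (b * P : ℝ))).add
        ((hsqrt.add (hinv.mul hsqrt)).const_mul c)
      simpa using this
    have hlim' := ENNReal.tendsto_ofReal hlim
    rw [ENNReal.ofReal_coe_nnreal] at hlim'
    rw [← hlim'.limsup_eq]
    refine limsup_le_limsup ?_
    -- Block length 0 must be discarded: there `(n : ℝ≥0∞)⁻¹` is infinite while the real inverse is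
    -- 0.
    filter_upwards [eventually_gt_atTop 0] with n hn
    have hn' : (0 : ℝ) < n := by exact_mod_cast hn
    refine (hW n).trans (le_of_eq ?_)
    rw [← ENNReal.ofReal_natCast, ← ENNReal.ofReal_inv_of_pos hn',
      ← ENNReal.ofReal_mul (by positivity)]
    congr 1
    have hs : √((n : ℝ) + 1) ^ 2 = n + 1 := Real.sq_sqrt (by positivity)
    have hs0 : √((n : ℝ) + 1) ≠ 0 := (Real.sqrt_pos.2 (by positivity)).ne'
    field_simp
    linear_combination c * hs

end Achievability

end BroadcastFeedback

theorem theorem1 (k : ℕ) (a : Fin k → ℂ) (ha : Function.Injective a) (ha1 : ∀ j, 1 < ‖a j‖)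
    (Kz : Matrix (Fin k) (Fin k) ℂ) (hKz : Kz.PosSemidef) :
    (∃! G : Matrix (Fin k) (Fin k) ℂ, BroadcastFeedback.IsStabilizingSolution a G) ∧
    ∀ G : Matrix (Fin k) (Fin k) ℂ, BroadcastFeedback.IsStabilizingSolution a G →
      (∃! Ks : Matrix (Fin k) (Fin k) ℂ, BroadcastFeedback.IsLyapunovSolution a G Kz Ks) ∧
      ∀ Ks : Matrix (Fin k) (Fin k) ℂ, BroadcastFeedback.IsLyapunovSolution a G Kz Ks →
        ∃ P : ℝ≥0,
          (BroadcastFeedback.gainC a G * Ks * (BroadcastFeedback.gainC a G)ᴴ) 0 0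
            = ((P : ℝ) : ℂ) ∧
          (G * Kz).trace = ((P : ℝ) : ℂ) ∧
          BroadcastFeedback.ComplexAchievable Kz (fun j => Real.logb 2 ‖a j‖) P ∧
          ∀ K : Matrix (Fin k) (Fin k) ℝ, K.map (fun x : ℝ => (x : ℂ)) = Kz →
            BroadcastFeedback.Achievable K (fun j => Real.logb 2 ‖a j‖) P := by
  open BroadcastFeedback in
  refine ⟨existsUnique_isStabilizingSolution ha ha1, fun G hG =>
    ⟨existsUnique_isLyapunovSolution ha1 hG.1 hG.2.1 Kz, fun Ks hKs => ?_⟩⟩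
  obtain ⟨hre, him⟩ := Complex.le_def.1
    (BroadcastFeedback.trace_mul_nonneg hG.1.posSemidef hKz)
  have htr : (G * Kz).trace = (((⟨(G * Kz).trace.re, hre⟩ : ℝ≥0) : ℝ) : ℂ) :=
    Complex.ext rfl him.symm
  refine ⟨⟨(G * Kz).trace.re, hre⟩, ?_, htr, ?_, ?_⟩
  · rw [BroadcastFeedback.gainC_mul_mul hG.1 hG.2.1 hKs]
    exact htr
  · exact (BroadcastFeedback.isNoise_complexNoise hKz).achievableOver (mul_one 2) ha1 hG.1
      hG.2.1 hKz rfl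
  · rintro K rfl
    exact (BroadcastFeedback.isNoise_realNoise hKz).achievableOver (one_mul 2) ha1 hG.1
      hG.2.1 hKz rfl
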